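/- Consider a first-price auction with two bidders, a leader $A$ and a follower $B$, whose types $x$ and $y$ are independent and uniform on $[0,1]$. The leader commits to a Bayesian strategy $s$ assigning to each type a (possibly random) bid; the follower knows $s$ but not the leader's type. Let $P_B[t]$ be the probability that the leader's bid is at most $t$ (ties go to the follower). A follower of type $y$ chooses a bid $t\ge 0$ maximizing $(y-t)P_B[t]$; let $u_B(y)$ be the supremum of this payoff. For every strategy $s$ and every $y\in[0,1]$ the supremum is attained and there is a lowest best response, which the follower submits. The leader wins iff his bid is strictly higher than the follower's, then pays his bid, and $u_A(s)$ denotes his expected utility. For $x\in(0,1]$ let $eu_B(y,x)=y-u_B(y)/x$, let $\bar s(x)=\sup_{y\in[0,1]}eu_B(y,x)$ (the smoothing of $s$), and let the equal-bid function of $s$ be $g(x)=\min\{y\in[0,1]: eu_B(y,x)=\bar s(x)\}$. Admissible equal-bid functions are the weakly increasing, left-continuous $g:(0,1]\to[0,1]$; such a $g$ determines the bid function $s_g(x)=\frac1x\int_0^x g(t)\,dt$ and the leader's utility $J(g)=\int_0^1 (x-s_g(x))\,F_2[g(x)]\,dx$, where $F_2$ is the distribution function of $y$. Theorem. There is a unique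 $t_0>0$ with $t_0=-\ln t_0$ (equivalently $t_0=\int_{t_0}^1\frac{dx}{x}$); it lies in $(0,1)$ and $|t_0-0.567|<0.0005$. Put $$g^*(x)=\begin{cases}0 & x\le t_0\\ 1 & x>t_0\end{cases}\qquad s_A^*(x)=\begin{cases}0 & x\le t_0\\ 1-\frac{t_0}{x} & x>t_0.\end{cases}$$ 1. $g^*$ is the unique maximizer of $J$ among the admissible equal-bid functions. 2. On $(0,1]$: $s_{g^*}=s_A^*$, the smoothing of $s_A^*$ is $s_A^*$ itself, and the equal-bid function of $s_A^*$ is $g^*$. 3. $s_A^*$ is an optimal commitment: $u_A(s)\le u_A(s_A^*)$ for every Bayesian strategy $s$ of the leader. Every weakly increasing nonnegative pure strategy that is also optimal agrees with $s_A^*$ on $[0,1)$. 4. The leader's optimal utility is $u_A(s_A^*)=J(g^*)=t_0+\frac{t_0^2}{2}-\frac12$, and $|u_A(s_A^*)-0.228|<0.0005$. -/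

import Mathlib

open MeasureTheory ProbabilityTheory Set

namespace FirstPriceCommitment

noncomputable section

/-- The law of each bidder's type: the uniform distribution on `[0,1]`. -/
def typeLaw : Measure ℝ := volume.restrict (Icc 0 1)

instance : IsProbabilityMeasure typeLaw :=
  ⟨by simp [typeLaw]⟩

/-! A Bayesian strategy of the leader assigns to each type a bid distribution: it is a Markov
kernel `s : Kernel ℝ ℝ` (only its values at types in `[0,1]` matter). -/

/-- The deterministic strategy in which the leader of type `x` bids `f x`. -/
def pureStrategy (f : ℝ → ℝ) (hf : Measurable f) : Kernel ℝ ℝ := Kernel.deterministic f hf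

instance (f : ℝ → ℝ) (hf : Measurable f) : IsMarkovKernel (pureStrategy f hf) := by
  unfold pureStrategy; infer_instance

/-- The follower's winning probability when she bids `t` against `s`: the probability that the
leader's bid is at most `t` (ties go to the follower). -/
def followerWin (s : Kernel ℝ ℝ) (t : ℝ) : ℝ := (typeLaw.bind s).real (Iic t)

/-- First-price payoff of the follower of type `y` bidding `t` against `s`. -/
def followerPayoff (s : Kernel ℝ ℝ) (y t : ℝ) : ℝ := (y - t) * followerWin s t

/-- `u_B(y)`: the supremum of the follower's payoff over her bids `t ≥ 0`. -/
def followerUtility (s : Kernel ℝ ℝ) (y : ℝ) : ℝ := sSup (followerPayoff s y '' Ici 0)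

/-- `S_B(y)`: the best responses of the follower of type `y` against `s`. -/
def bestResponses (s : Kernel ℝ ℝ) (y : ℝ) : Set ℝ :=
  {t | 0 ≤ t ∧ ∀ t', 0 ≤ t' → followerPayoff s y t' ≤ followerPayoff s y t}

/-- The follower submits her lowest best response. -/
def response (s : Kernel ℝ ℝ) (y : ℝ) : ℝ := sInf (bestResponses s y)

/-- The leader's winning probability with bid `b`: the follower's bid must be strictly lower. -/
def leaderWin (s : Kernel ℝ ℝ) (b : ℝ) : ℝ := typeLaw.real {y | response s y < b}

/-- First-price payoff of the leader of type `x` bidding `b`, having committed to `s`. -/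
def leaderPayoff (s : Kernel ℝ ℝ) (p : ℝ × ℝ) : ℝ := (p.1 - p.2) * leaderWin s p.2

/-- `u_A(s)`: the leader's expected utility, over his type and his randomized bid. The payoff is
bounded above where the type lies in `[0,1]` and the bid is nonnegative, and it is zero at negative
bids; so the true expectation is either finite or `-∞`. In the latter case the integral below is
`0`, which overstates the utility. -/
def leaderUtility (s : Kernel ℝ ℝ) : ℝ := ∫ p, leaderPayoff s p ∂(typeLaw ⊗ₘ s)

/-- Equal-utility curve `eu_B(y,x)`, `x ∈ (0,1]`: the unique solution `t` of
`u_B(y) = x * (y - t)`. -/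
def equalUtility (s : Kernel ℝ ℝ) (y x : ℝ) : ℝ := y - followerUtility s y / x

/-- The smoothing of a strategy: the upper envelope of its equal-utility curves. -/
def smoothed (s : Kernel ℝ ℝ) (x : ℝ) : ℝ := sSup ((fun y => equalUtility s y x) '' Icc 0 1)

/-- `Y(x)`: the follower types whose equal-utility curve passes through `(x, smoothed s x)`. The
equal-bid function of `s` at `x` is the minimum of this set. -/
def equalBidTypes (s : Kernel ℝ ℝ) (x : ℝ) : Set ℝ :=
  {y | y ∈ Icc (0 : ℝ) 1 ∧ equalUtility s y x = smoothed s x}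

/-- The admissible equal-bid functions: `[0,1]`-valued, weakly increasing and left continuous on
`(0,1]`. -/
structure IsEqualBid (g : ℝ → ℝ) : Prop where
  mem : ∀ x ∈ Ioc (0 : ℝ) 1, g x ∈ Icc (0 : ℝ) 1
  mono : MonotoneOn g (Ioc 0 1)
  leftCont : ∀ x ∈ Ioc (0 : ℝ) 1, ContinuousWithinAt g (Iic x) x

/-- The leader's bid function determined by an equal-bid function `g`. -/
def bidOf (g : ℝ → ℝ) (x : ℝ) : ℝ := 1 / x * ∫ t in (0 : ℝ)..x, g t

/-- The leader's utility as a functional of the equal-bid function: type `x` bids `bidOf g x` and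
wins against the follower's types up to `g x`. -/
def objective (g : ℝ → ℝ) : ℝ :=
  ∫ x in (0 : ℝ)..1, (x - bidOf g x) * typeLaw.real (Iic (g x))

/-- The step function that is `0` up to `t₀` and `1` afterwards. -/
def stepG (t₀ x : ℝ) : ℝ := if x ≤ t₀ then 0 else 1

/-- The bid function that is `0` up to `t₀` and `1 - t₀ / x` afterwards. -/
def stepBid (t₀ x : ℝ) : ℝ := if x ≤ t₀ then 0 else 1 - t₀ / x

theorem measurable_stepBid (t₀ : ℝ) : Measurable (stepBid t₀) := by
  unfold stepBid
  exact Measurable.ite measurableSet_Iic measurable_const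
    (measurable_const.sub (measurable_const.div measurable_id))

/-- The pure strategy with bid function `stepBid t₀`. -/
def stepStrategy (t₀ : ℝ) : Kernel ℝ ℝ := pureStrategy (stepBid t₀) (measurable_stepBid t₀)

end

end FirstPriceCommitment

namespace FirstPriceCommitment

open Filter Topology

/-! ### The threshold -/

/-! Convex duality turns the leader's problem into the maximization of a concave quadratic
functional. Against a strategy `s` the follower's utility `u` has her winning probability
`responseWin` as a monotone selection of subgradients (`followerUtility_sub_le`,
`monotoneOn_responseWin`). The generalized inverse h = `losingShare s` therefore maximizes x * y -
u(y) over y (`mul_sub_followerUtility_le`), so the conjugate φ(x) = x * h(x) - u(h(x)) is the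
primitive of h (`integral_losingShare`) and `bidOf h x` = φ(x)/x.

Any strategy earns at most `objective h` (`leaderUtility_le_objective`). Its bids have the law of
their quantile function Q under a uniform type, and bid Q(x) wins with probability h(x). Coupling
types and bids monotonically can only increase ∫ x * win: Fenchel-Young gives x * w ≤ φ(x) + u(w),
with equality at w = h(x). Moreover Q(x) ≥ φ(x)/x wherever h(x) > 0, since the follower of type h(x)
could bid Q(x) and win with probability at least x.

It remains to maximize `objective` over monotone g. With k = g - `stepG t₀` and K its primitive,
`objective g` equals `objective (stepG t₀)` + ∫ `objectiveGradient` * k - ∫ K²/(2x²) - K(1)²/2. The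
gradient is t - `stepBid t₀ t` - ∫ `stepG t₀ x` / x over [t,1], whose last term is log max(t, t₀).
The equation t₀ = -log t₀ makes it change sign exactly at t₀, from negative to positive, so the
linear term is nonpositive and vanishes only if k = 0 almost everywhere. Uniqueness of the strategy
follows by tracing equality through these estimates. -/

theorem exists_threshold :
    ∃ t₀ : ℝ, 0.567 < t₀ ∧ t₀ < 0.5674 ∧ t₀ = -Real.log t₀ ∧
      ∀ t : ℝ, 0 < t → t = -Real.log t → t = t₀ := by
  have hmono : ∀ a b : ℝ, 0 < a → a < b → a + Real.log a < b + Real.log b := fun a b ha hab =>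
    add_lt_add hab (Real.log_lt_log ha hab)
  have h1 : (0.567 : ℝ) + Real.log 0.567 < 0 := by
    have : Real.log 0.567 < -0.567 := by
      rw [Real.log_lt_iff_lt_exp (by norm_num), Real.exp_neg, lt_inv_comm₀ (by norm_num)
        (Real.exp_pos _)]
      refine (Real.exp_bound' (n := 6) (by norm_num) (by norm_num) (by norm_num)).trans_lt ?_
      norm_num [Finset.sum_range_succ, Nat.factorial]
    linarith
  -- The right end is tighter than 0.5675 on purpose: at 0.5675 the utility t + t²/2 - 1/2 already
  -- exceeds 0.2285.
  have h2 : 0 < (0.5674 : ℝ) + Real.log 0.5674 := by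
    have : -0.5674 < Real.log 0.5674 := by
      rw [Real.lt_log_iff_exp_lt (by norm_num), Real.exp_neg, inv_lt_comm₀ (Real.exp_pos _)
        (by norm_num)]
      refine lt_of_lt_of_le ?_ (Real.sum_le_exp_of_nonneg (by norm_num) 6)
      norm_num [Finset.sum_range_succ, Nat.factorial]
    linarith
  have hcont : ContinuousOn (fun t : ℝ => t + Real.log t) (Icc 0.567 0.5674) :=
    continuousOn_id.add (Real.continuousOn_log.mono fun x hx => by
      have := hx.1
      simp only [mem_compl_iff, mem_singleton_iff]
      intro h
      rw [h] at this
      norm_num at this)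
  obtain ⟨t, ht, h0⟩ := intermediate_value_Ioo (by norm_num) hcont ⟨h1, h2⟩
  simp only at h0
  have ht0 : 0 < t := lt_trans (by norm_num) ht.1
  refine ⟨t, ht.1, ht.2, by linarith, fun u hu hu' => ?_⟩
  rcases lt_trichotomy u t with h | h | h
  · linarith [hmono u t hu h]
  · exact h
  · linarith [hmono t u ht0 h]

/-! ### Integrals over the type law -/

theorem typeLaw_eq_Ioc : typeLaw = volume.restrict (Ioc (0 : ℝ) 1) :=
  (restrict_Ioc_eq_restrict_Icc).symm

theorem integral_typeLaw (f : ℝ → ℝ) : ∫ x, f x ∂typeLaw = ∫ x in (0 : ℝ)..1, f x := by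
  rw [typeLaw_eq_Ioc, intervalIntegral.integral_of_le zero_le_one]

theorem typeLaw_real_Iic {c : ℝ} (hc : c ∈ Icc (0 : ℝ) 1) : typeLaw.real (Iic c) = c := by
  have : Iic c ∩ Icc 0 1 = Icc 0 c := by
    ext x
    simp only [mem_inter_iff, mem_Iic, mem_Icc]
    constructor
    · rintro ⟨h1, h2, -⟩
      exact ⟨h2, h1⟩
    · rintro ⟨h1, h2⟩
      exact ⟨h2, h1, h2.trans hc.2⟩
  rw [measureReal_def, typeLaw, Measure.restrict_apply measurableSet_Iic, this, Real.volume_Icc,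
    sub_zero, ENNReal.toReal_ofReal hc.1]

theorem ae_typeLaw_of_forall {P : ℝ → Prop} (h : ∀ x ∈ Ioo (0 : ℝ) 1, P x) :
    ∀ᵐ x ∂typeLaw, P x := by
  rw [typeLaw, ← restrict_Ioo_eq_restrict_Icc]
  exact (ae_restrict_iff' measurableSet_Ioo).2 (.of_forall h)

theorem integrable_typeLaw_of_bound {f : ℝ → ℝ} (hf : Measurable f) (C : ℝ)
    (h : ∀ x ∈ Ioc (0 : ℝ) 1, |f x| ≤ C) : Integrable f typeLaw :=
  Integrable.of_bound hf.aestronglyMeasurable C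
    (ae_typeLaw_of_forall fun x hx => h x ⟨hx.1, hx.2.le⟩)

theorem intervalIntegrable_of_bound {f : ℝ → ℝ} (hf : Measurable f) (C : ℝ)
    (h : ∀ x ∈ Ioc (0 : ℝ) 1, |f x| ≤ C) : IntervalIntegrable f volume 0 1 := by
  rw [intervalIntegrable_iff_integrableOn_Ioc_of_le zero_le_one, IntegrableOn, ← typeLaw_eq_Ioc]
  exact integrable_typeLaw_of_bound hf C h

/-! ### The step function -/

theorem monotone_stepG (t₀ : ℝ) : Monotone (stepG t₀) := by
  intro a b hab
  unfold stepG
  split_ifs with h1 h2 <;> first | exact le_rfl | exact zero_le_one | exact absurd (hab.trans ‹b ≤ t₀›) h1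

theorem stepG_mem (t₀ x : ℝ) : stepG t₀ x ∈ Icc (0 : ℝ) 1 := by
  unfold stepG
  split_ifs <;> norm_num

theorem hasDerivAt_max_sub {t₀ x : ℝ} (h : x ≠ t₀) :
    HasDerivAt (fun x => max (x - t₀) 0) (stepG t₀ x) x := by
  rcases lt_or_gt_of_ne h with h | h
  · rw [stepG, if_pos h.le]
    refine (hasDerivAt_const x (0 : ℝ)).congr_of_eventuallyEq ?_
    filter_upwards [Iio_mem_nhds h] with y hy
    exact max_eq_right (by linarith [mem_Iio.1 hy])
  · rw [stepG, if_neg (not_le.2 h)]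
    refine ((hasDerivAt_id x).sub_const t₀).congr_of_eventuallyEq ?_
    filter_upwards [Ioi_mem_nhds h] with y hy
    exact max_eq_left (by linarith [mem_Ioi.1 hy])

theorem integral_stepG {t₀ : ℝ} (h0 : 0 ≤ t₀) (x : ℝ) :
    ∫ t in (0 : ℝ)..x, stepG t₀ t = max (x - t₀) 0 := by
  rw [integral_eq_of_hasDerivAt_off_countable (fun x => max (x - t₀) 0) (stepG t₀)
    (countable_singleton t₀) (by fun_prop)
    (fun x hx => hasDerivAt_max_sub hx.2) (monotone_stepG t₀).intervalIntegrable]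
  simp [h0]

theorem stepBid_eq {t₀ x : ℝ} (hx : 0 < x) : stepBid t₀ x = max (x - t₀) 0 / x := by
  unfold stepBid
  split_ifs with h
  · rw [max_eq_right (by linarith), zero_div]
  · rw [max_eq_left (by linarith)]
    field_simp

theorem bidOf_stepG {t₀ x : ℝ} (h0 : 0 ≤ t₀) (hx : 0 < x) :
    bidOf (stepG t₀) x = stepBid t₀ x := by
  rw [bidOf, integral_stepG h0, stepBid_eq hx]
  ring

theorem stepBid_mem {t₀ x : ℝ} (h0 : 0 ≤ t₀) (hx : 0 < x) : stepBid t₀ x ∈ Icc (0 : ℝ) 1 := by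
  unfold stepBid
  split_ifs with h
  · norm_num
  · push Not at h
    constructor
    · rw [sub_nonneg, div_le_one hx]
      exact h.le
    · have : 0 ≤ t₀ / x := by positivity
      linarith

theorem isEqualBid_stepG {t₀ : ℝ} : IsEqualBid (stepG t₀) where
  mem x _ := stepG_mem t₀ x
  mono := (monotone_stepG t₀).monotoneOn _
  leftCont x _ := by
    by_cases h : x ≤ t₀
    · refine (continuousWithinAt_const (b := (0 : ℝ))).congr (fun y hy => ?_) ?_
      · exact if_pos (le_trans hy h)
      · exact if_pos h
    · refine ContinuousAt.continuousWithinAt ?_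
      refine (continuousAt_const (y := (1 : ℝ))).congr ?_
      filter_upwards [Ioi_mem_nhds (not_le.1 h)] with y hy
      exact (if_neg (not_le.2 hy)).symm

/-! ### Optimality of the step function -/

/-- The derivative of `objective` at the step function, in the direction of a unit mass at `t`. -/
noncomputable def objectiveGradient (t₀ t : ℝ) : ℝ :=
  t - stepBid t₀ t + Real.log (max t t₀)

theorem objectiveGradient_neg {t₀ t : ℝ} (h : t₀ = -Real.log t₀) (ht : t < t₀) :
    objectiveGradient t₀ t < 0 := by
  rw [objectiveGradient, stepBid, if_pos ht.le, max_eq_right ht.le]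
  linarith

/-- Here the gradient is t - 1 + t₀/t + log t. From log (t/t₀) ≥ 1 - t₀/t and log t₀ = -t₀ it is at
least t - t₀. -/
theorem objectiveGradient_pos {t₀ t : ℝ} (h0 : 0 < t₀) (h : t₀ = -Real.log t₀) (ht : t₀ < t) :
    0 < objectiveGradient t₀ t := by
  have htp := h0.trans ht
  rw [objectiveGradient, stepBid, if_neg (not_le.2 ht), max_eq_left ht.le]
  have := Real.one_sub_inv_le_log_of_pos (div_pos htp h0)
  rw [Real.log_div htp.ne' h0.ne', inv_div] at this
  linarith

theorem measurable_objectiveGradient (t₀ : ℝ) : Measurable (objectiveGradient t₀) := by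
  unfold objectiveGradient
  exact (measurable_id.sub (measurable_stepBid t₀)).add
    (Real.measurable_log.comp (measurable_id.max measurable_const))

theorem abs_log_max_le {t₀ t : ℝ} (h0 : 0 < t₀) (h1 : t₀ < 1) (h : t₀ = -Real.log t₀)
    (ht : t ≤ 1) : |Real.log (max t t₀)| ≤ 1 := by
  have h2 : Real.log t₀ ≤ Real.log (max t t₀) := Real.log_le_log h0 (le_max_right _ _)
  have h3 : Real.log (max t t₀) ≤ 0 :=
    Real.log_nonpos (h0.le.trans (le_max_right _ _)) (max_le ht h1.le)
  rw [abs_le]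
  constructor <;> linarith

theorem abs_objectiveGradient_le {t₀ t : ℝ} (h0 : 0 < t₀) (h1 : t₀ < 1) (h : t₀ = -Real.log t₀)
    (ht : t ∈ Ioc (0 : ℝ) 1) : |objectiveGradient t₀ t| ≤ 2 := by
  have h2 := abs_le.1 (abs_log_max_le h0 h1 h ht.2)
  have h3 := stepBid_mem (t₀ := t₀) h0.le ht.1
  rw [objectiveGradient, abs_le]
  constructor <;> linarith [h3.1, h3.2, ht.1, ht.2]

theorem objectiveGradient_mul_nonpos {t₀ t c : ℝ} (h0 : 0 < t₀) (h : t₀ = -Real.log t₀)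
    (hc : c ∈ Icc (0 : ℝ) 1) : objectiveGradient t₀ t * (c - stepG t₀ t) ≤ 0 := by
  rcases lt_trichotomy t t₀ with ht | ht | ht
  · rw [stepG, if_pos ht.le]
    exact mul_nonpos_of_nonpos_of_nonneg (objectiveGradient_neg h ht).le (by linarith [hc.1])
  · have : objectiveGradient t₀ t = 0 := by
      rw [objectiveGradient, stepBid, if_pos ht.le, ht, max_self]
      linarith
    simp [this]
  · rw [stepG, if_neg (not_le.2 ht)]
    exact mul_nonpos_of_nonneg_of_nonpos (objectiveGradient_pos h0 h ht).le (by linarith [hc.2])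

theorem objective_eq {g : ℝ → ℝ} (hg : ∀ x ∈ Ioc (0 : ℝ) 1, g x ∈ Icc (0 : ℝ) 1) :
    objective g = ∫ x in (0 : ℝ)..1, (x - bidOf g x) * g x := by
  refine intervalIntegral.integral_congr_ae (.of_forall fun x hx => ?_)
  rw [uIoc_of_le zero_le_one] at hx
  simp only [typeLaw_real_Iic (hg x hx)]

section Monotone

variable {g : ℝ → ℝ}

theorem continuous_integral_of_monotone (hm : Monotone g) :
    Continuous fun x => ∫ t in (0 : ℝ)..x, g t :=
  intervalIntegral.continuous_primitive (fun _ _ => hm.intervalIntegrable) 0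

theorem integral_mem_of_mem (hm : Monotone g) (hg : ∀ x, g x ∈ Icc (0 : ℝ) 1) {x : ℝ}
    (hx : 0 ≤ x) : (∫ t in (0 : ℝ)..x, g t) ∈ Icc 0 x := by
  constructor
  · exact intervalIntegral.integral_nonneg hx fun t _ => (hg t).1
  · refine (intervalIntegral.integral_mono hx hm.intervalIntegrable
      (g := fun _ => (1 : ℝ)) (by simp) fun t => (hg t).2).trans ?_
    simp

theorem bidOf_mem (hm : Monotone g) (hg : ∀ x, g x ∈ Icc (0 : ℝ) 1) {x : ℝ}
    (hx : 0 < x) : bidOf g x ∈ Icc (0 : ℝ) 1 := by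
  have := integral_mem_of_mem hm hg hx.le
  rw [bidOf, one_div, inv_mul_eq_div]
  exact ⟨div_nonneg this.1 hx.le, (div_le_one hx).2 this.2⟩

theorem measurable_bidOf (hm : Monotone g) : Measurable (bidOf g) :=
  (measurable_const.div measurable_id).mul (continuous_integral_of_monotone hm).measurable

theorem abs_sub_bidOf_mul_le (hm : Monotone g) (hg : ∀ x, g x ∈ Icc (0 : ℝ) 1) {x : ℝ}
    (hx : x ∈ Ioc (0 : ℝ) 1) : |(x - bidOf g x) * g x| ≤ 1 := by
  have h1 := bidOf_mem hm hg hx.1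
  have h2 := hg x
  rw [abs_mul, ← one_mul (1 : ℝ)]
  refine mul_le_mul ?_ ?_ (abs_nonneg _) zero_le_one
  · rw [abs_le]; constructor <;> linarith [h1.1, h1.2, hx.1, hx.2]
  · rw [abs_le]; constructor <;> linarith [h2.1, h2.2]

theorem measurable_sub_bidOf_mul (hm : Monotone g) :
    Measurable fun x => (x - bidOf g x) * g x :=
  (measurable_id.sub (measurable_bidOf hm)).mul hm.measurable

theorem intervalIntegrable_sub_bidOf_mul (hm : Monotone g) (hg : ∀ x, g x ∈ Icc (0 : ℝ) 1) :
    IntervalIntegrable (fun x => (x - bidOf g x) * g x) volume 0 1 :=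
  intervalIntegrable_of_bound (measurable_sub_bidOf_mul hm) 1
    fun _ hx => abs_sub_bidOf_mul_le hm hg hx

theorem abs_objectiveGradient_mul_le {t₀ : ℝ} (h0 : 0 < t₀) (h1 : t₀ < 1) (h : t₀ = -Real.log t₀)
    (hg : ∀ x, g x ∈ Icc (0 : ℝ) 1) {x : ℝ} (hx : x ∈ Ioc (0 : ℝ) 1) :
    |objectiveGradient t₀ x * (g x - stepG t₀ x)| ≤ 2 := by
  rw [abs_mul, ← mul_one (2 : ℝ)]
  refine mul_le_mul (abs_objectiveGradient_le h0 h1 h hx) ?_ (abs_nonneg _) zero_le_two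
  have h3 := hg x
  have h4 := stepG_mem t₀ x
  rw [abs_le]
  constructor <;> linarith [h3.1, h3.2, h4.1, h4.2]

theorem measurable_objectiveGradient_mul (t₀ : ℝ) (hm : Monotone g) :
    Measurable fun x => objectiveGradient t₀ x * (g x - stepG t₀ x) :=
  (measurable_objectiveGradient t₀).mul (hm.measurable.sub (monotone_stepG t₀).measurable)

/-- `objective` lies below its linearization at the step function. -/
theorem objective_le_linearization {t₀ : ℝ} (h0 : 0 < t₀) (h1 : t₀ < 1) (h : t₀ = -Real.log t₀)
    (hm : Monotone g) (hg : ∀ x, g x ∈ Icc (0 : ℝ) 1) :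
    objective g ≤ objective (stepG t₀) +
      ∫ x in (0 : ℝ)..1, objectiveGradient t₀ x * (g x - stepG t₀ x) := by
  rw [objective_eq fun x _ => hg x, objective_eq fun x _ => stepG_mem t₀ x]
  set K : ℝ → ℝ := fun x => (∫ t in (0 : ℝ)..x, g t) - max (x - t₀) 0 with hK
  have hKc : Continuous K := (continuous_integral_of_monotone hm).sub (by fun_prop)
  have hK0 : K 0 = 0 := by simp [hK, h0.le]
  have hKb : ∀ x, 0 ≤ x → |K x| ≤ x := fun x hx => by
    have h2 := integral_mem_of_mem hm hg hx
    have h3 := integral_mem_of_mem (monotone_stepG t₀) (stepG_mem t₀) hx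
    rw [integral_stepG h0.le] at h3
    simp only [hK]
    rw [abs_le]
    constructor <;> linarith [h2.1, h2.2, h3.1, h3.2]
  have hbid : ∀ x, 0 < x → bidOf g x = (K x + max (x - t₀) 0) / x := fun x hx => by
    simp only [hK, bidOf]
    ring
  -- `D` is a primitive of the integrand difference minus its linear part plus K²/(2x²), found by
  -- integrating the two cross terms by parts. The bound |K x| ≤ x makes it continuous at 0, where
  -- division by zero gives the right value 0.
  set D : ℝ → ℝ := fun x => -(K x * Real.log (max x t₀)) - K x ^ 2 / (2 * x) with hD
  set D' : ℝ → ℝ := fun x => (x - bidOf g x) * g x - (x - bidOf (stepG t₀) x) * stepG t₀ x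
    - objectiveGradient t₀ x * (g x - stepG t₀ x) + K x ^ 2 / (2 * x ^ 2) with hD'
  have hi1 := intervalIntegrable_sub_bidOf_mul hm hg
  have hi2 := intervalIntegrable_sub_bidOf_mul (monotone_stepG t₀) (stepG_mem t₀)
  have hi3 : IntervalIntegrable (fun x => objectiveGradient t₀ x * (g x - stepG t₀ x))
      volume 0 1 :=
    intervalIntegrable_of_bound (measurable_objectiveGradient_mul t₀ hm) 2
      fun x hx => abs_objectiveGradient_mul_le h0 h1 h hg hx
  have hi4 : IntervalIntegrable (fun x => K x ^ 2 / (2 * x ^ 2)) volume 0 1 := by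
    refine intervalIntegrable_of_bound ((hKc.measurable.pow_const 2).div (by fun_prop)) 1
      fun x hx => ?_
    have hxp : 0 < x := hx.1
    rw [abs_of_nonneg (by positivity), div_le_one (by positivity)]
    have := sq_le_sq.2 ((hKb x hxp.le).trans (le_abs_self x))
    nlinarith [sq_nonneg x]
  have hDc : ContinuousOn D (Icc 0 1) := by
    refine ContinuousOn.sub ?_ ?_
    · refine (hKc.mul (Continuous.log (by fun_prop) fun x => ?_)).neg.continuousOn
      exact (h0.trans_le (le_max_right _ _)).ne'
    · intro x hx
      rcases hx.1.eq_or_lt with rfl | hx0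
      · rw [ContinuousWithinAt, hK0]
        simp only [mul_zero, div_zero]
        refine squeeze_zero_norm' (a := fun x => x) ?_ ?_
        · filter_upwards [self_mem_nhdsWithin] with x hx
          have hx0 : 0 ≤ x := hx.1
          rw [Real.norm_of_nonneg (by positivity)]
          refine div_le_of_le_mul₀ (by positivity) hx0 ?_
          have := sq_le_sq.2 ((hKb x hx0).trans (le_abs_self x))
          nlinarith [sq_nonneg x]
        · exact (continuous_id.tendsto' 0 0 rfl).mono_left nhdsWithin_le_nhds
      · exact ((hKc.continuousAt.pow 2).div (by fun_prop) (by positivity)).continuousWithinAt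
  have hder : ∀ x ∈ Ioo (min (0 : ℝ) 1) (max 0 1) \ ({x | ¬ContinuousAt g x} ∪ {t₀}),
      HasDerivAt D (D' x) x := by
    rintro x ⟨hx, hx'⟩
    rw [min_eq_left zero_le_one, max_eq_right zero_le_one] at hx
    simp only [mem_union, mem_ofPred_eq, mem_singleton_iff, not_or, not_not] at hx'
    have hxp : 0 < x := hx.1
    have hKd : HasDerivAt K (g x - stepG t₀ x) x :=
      (intervalIntegral.integral_hasDerivAt_right hm.intervalIntegrable
        hm.measurable.stronglyMeasurable.stronglyMeasurableAtFilter hx'.1).sub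
        (hasDerivAt_max_sub hx'.2)
    have hLd : HasDerivAt (fun x => Real.log (max x t₀)) (stepG t₀ x / x) x := by
      rcases lt_or_gt_of_ne hx'.2 with h | h
      · rw [stepG, if_pos h.le, zero_div]
        refine (hasDerivAt_const x (Real.log t₀)).congr_of_eventuallyEq ?_
        filter_upwards [Iio_mem_nhds h] with y hy
        rw [max_eq_right (le_of_lt hy)]
      · rw [stepG, if_neg (not_le.2 h), one_div]
        refine (Real.hasDerivAt_log hxp.ne').congr_of_eventuallyEq ?_
        filter_upwards [Ioi_mem_nhds h] with y hy
        rw [max_eq_left (le_of_lt hy)]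
    have := (hKd.mul hLd).neg.sub ((hKd.pow 2).div ((hasDerivAt_id x).const_mul 2)
      (by simp [hxp.ne']))
    refine this.congr_deriv ?_
    simp only [hD', hbid x hxp, bidOf_stepG h0.le hxp, objectiveGradient, stepBid_eq hxp, id,
      Pi.pow_apply]
    field_simp
    ring
  have hFTC := integral_eq_of_hasDerivAt_off_countable D D'
    (hm.countable_not_continuousAt.union (countable_singleton t₀))
    (by rwa [uIcc_of_le zero_le_one]) hder (((hi1.sub hi2).sub hi3).add hi4)
  rw [hD', intervalIntegral.integral_add ((hi1.sub hi2).sub hi3) hi4,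
    intervalIntegral.integral_sub (hi1.sub hi2) hi3, intervalIntegral.integral_sub hi1 hi2] at hFTC
  have hD0 : D 0 = 0 := by simp [hD, hK0]
  -- Only -K(1)²/2 survives, because log 1 = 0.
  have hD1 : D 1 ≤ 0 := by
    simp only [hD, max_eq_left h1.le, Real.log_one]
    nlinarith [sq_nonneg (K 1)]
  have hpos : 0 ≤ ∫ x in (0 : ℝ)..1, K x ^ 2 / (2 * x ^ 2) :=
    intervalIntegral.integral_nonneg zero_le_one fun x _ => by positivity
  linarith

theorem objective_le_of_monotone {t₀ : ℝ} (h0 : 0 < t₀) (h1 : t₀ < 1) (h : t₀ = -Real.log t₀)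
    (hm : Monotone g) (hg : ∀ x, g x ∈ Icc (0 : ℝ) 1) :
    objective g ≤ objective (stepG t₀) := by
  refine (objective_le_linearization h0 h1 h hm hg).trans (add_le_of_nonpos_right ?_)
  rw [← integral_typeLaw]
  exact integral_nonpos fun x => objectiveGradient_mul_nonpos h0 h (hg x)

theorem ae_eq_stepG_of_objective_eq {t₀ : ℝ} (h0 : 0 < t₀) (h1 : t₀ < 1)
    (h : t₀ = -Real.log t₀) (hm : Monotone g) (hg : ∀ x, g x ∈ Icc (0 : ℝ) 1)
    (heq : objective g = objective (stepG t₀)) : g =ᵐ[typeLaw] stepG t₀ := by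
  have hle := objective_le_linearization h0 h1 h hm hg
  rw [← integral_typeLaw, heq] at hle
  have hnp : ∀ x, objectiveGradient t₀ x * (g x - stepG t₀ x) ≤ 0 := fun x =>
    objectiveGradient_mul_nonpos h0 h (hg x)
  have hz : ∫ x, -(objectiveGradient t₀ x * (g x - stepG t₀ x)) ∂typeLaw = 0 := by
    rw [integral_neg]
    linarith [integral_nonpos (μ := typeLaw) hnp]
  rw [integral_eq_zero_iff_of_nonneg (fun x => neg_nonneg.2 (hnp x))
    (integrable_typeLaw_of_bound (measurable_objectiveGradient_mul t₀ hm) 2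
      fun x hx => abs_objectiveGradient_mul_le h0 h1 h hg hx).neg] at hz
  have hne : ∀ᵐ x ∂typeLaw, x ≠ t₀ := by
    rw [typeLaw]
    exact ae_restrict_of_ae (Measure.ae_ne volume t₀)
  filter_upwards [hz, hne] with x hx hxne
  have : objectiveGradient t₀ x ≠ 0 := by
    rcases lt_or_gt_of_ne hxne with hlt | hgt
    · exact (objectiveGradient_neg h hlt).ne
    · exact (objectiveGradient_pos h0 h hgt).ne'
  simp only [Pi.zero_apply, neg_eq_zero, mul_eq_zero, this, false_or] at hx
  linarith

end Monotone

/-- Every left neighbourhood of x has positive measure, so it contains points of agreement; the two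
left limits then coincide. -/
theorem eqOn_of_ae_eq_of_leftCont {g g' : ℝ → ℝ} (hg : IsEqualBid g) (hg' : IsEqualBid g')
    (h : g =ᵐ[typeLaw] g') : EqOn g g' (Ioc 0 1) := by
  intro x hx
  rw [typeLaw_eq_Ioc, EventuallyEq, ae_restrict_iff' measurableSet_Ioc] at h
  refine tendsto_nhds_unique_of_frequently_eq
    ((hg.leftCont x hx).mono (Iio_subset_Iic_self (a := x)))
    ((hg'.leftCont x hx).mono (Iio_subset_Iic_self (a := x))) ?_
  rw [(nhdsLT_basis x).frequently_iff]
  intro a ha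
  have hlt : max a 0 < x := max_lt ha hx.1
  by_contra! hcon
  have hsub : Ioo (max a 0) x ⊆ {y | ¬(y ∈ Ioc (0 : ℝ) 1 → g y = g' y)} := fun y hy hy' =>
    hcon y ⟨(le_max_left _ _).trans_lt hy.1, hy.2⟩
      (hy' ⟨(le_max_right _ _).trans_lt hy.1, hy.2.le.trans hx.2⟩)
  have := measure_mono_null hsub h
  rw [Real.volume_Ioo, ENNReal.ofReal_eq_zero] at this
  linarith

theorem exists_monotone_extension {g : ℝ → ℝ} (hg : IsEqualBid g) :
    ∃ g' : ℝ → ℝ, Monotone g' ∧ (∀ x, g' x ∈ Icc (0 : ℝ) 1) ∧ EqOn g g' (Ioc 0 1) := by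
  refine ⟨fun x => if x ≤ 0 then 0 else if x ≤ 1 then g x else 1, ?_, ?_, ?_⟩
  · intro a b hab
    simp only
    split_ifs with h1 h2 h3 h4 h5 h6
    · exact le_rfl
    · exact (hg.mem b ⟨not_le.1 h2, h3⟩).1
    · exact zero_le_one
    · linarith
    · exact hg.mono ⟨not_le.1 h1, h4⟩ ⟨not_le.1 h5, h6⟩ hab
    · exact (hg.mem a ⟨not_le.1 h1, h4⟩).2
    · linarith
    · linarith
    · exact le_rfl
  · intro x
    simp only
    split_ifs with h1 h2
    · norm_num
    · exact hg.mem x ⟨not_le.1 h1, h2⟩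
    · norm_num
  · intro x hx
    simp [not_le.2 hx.1, hx.2]

theorem objective_congr {g g' : ℝ → ℝ} (h : EqOn g g' (Ioc 0 1)) : objective g = objective g' := by
  refine intervalIntegral.integral_congr_ae (.of_forall fun x hx => ?_)
  rw [uIoc_of_le zero_le_one] at hx
  have : ∫ t in (0 : ℝ)..x, g t = ∫ t in (0 : ℝ)..x, g' t := by
    refine intervalIntegral.integral_congr_ae (.of_forall fun t ht => ?_)
    rw [uIoc_of_le hx.1.le] at ht
    exact h ⟨ht.1, ht.2.trans hx.2⟩
  simp only [bidOf, this, h hx]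

theorem objective_le_stepG {t₀ : ℝ} (h0 : 0 < t₀) (h1 : t₀ < 1) (h : t₀ = -Real.log t₀)
    {g : ℝ → ℝ} (hg : IsEqualBid g) : objective g ≤ objective (stepG t₀) := by
  obtain ⟨g', hm, hmem, heq⟩ := exists_monotone_extension hg
  rw [objective_congr heq]
  exact objective_le_of_monotone h0 h1 h hm hmem

theorem eqOn_stepG_of_objective_eq {t₀ : ℝ} (h0 : 0 < t₀) (h1 : t₀ < 1) (h : t₀ = -Real.log t₀)
    {g : ℝ → ℝ} (hg : IsEqualBid g) (hobj : objective g = objective (stepG t₀)) :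
    EqOn g (stepG t₀) (Ioc 0 1) := by
  obtain ⟨g', hm, hmem, heq⟩ := exists_monotone_extension hg
  rw [objective_congr heq] at hobj
  refine eqOn_of_ae_eq_of_leftCont hg isEqualBid_stepG ?_
  have hae := ae_eq_stepG_of_objective_eq h0 h1 h hm hmem hobj
  have : g =ᵐ[typeLaw] g' := ae_typeLaw_of_forall fun x hx => heq ⟨hx.1, hx.2.le⟩
  exact this.trans hae

theorem sub_stepBid_mul_integral {t₀ : ℝ} (h0 : 0 < t₀) (h1 : t₀ < 1) (h : t₀ = -Real.log t₀) :
    ∫ x in (0 : ℝ)..1, (x - stepBid t₀ x) * stepG t₀ x = t₀ + t₀ ^ 2 / 2 - 1 / 2 := by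
  rw [integral_eq_of_hasDerivAt_off_countable
    -- Above t₀ the integrand is x - 1 + t₀/x; its primitive is frozen below t₀ by the maximum.
    (fun x => (max x t₀) ^ 2 / 2 - max x t₀ + t₀ * Real.log (max x t₀))
    (fun x => (x - stepBid t₀ x) * stepG t₀ x) (countable_singleton t₀)]
  · simp only [max_eq_left h1.le, max_eq_right h0.le, Real.log_one]
    have : Real.log t₀ = -t₀ := by linarith
    rw [this]
    ring
  · refine Continuous.continuousOn (Continuous.add (by fun_prop) (continuous_const.mul
      (Continuous.log (by fun_prop) fun x => (h0.trans_le (le_max_right _ _)).ne')))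
  · rintro x ⟨hx, hne⟩
    rw [min_eq_left zero_le_one, max_eq_right zero_le_one] at hx
    rcases lt_or_gt_of_ne (show x ≠ t₀ from hne) with hlt | hgt
    · rw [stepG, if_pos hlt.le, mul_zero]
      refine (hasDerivAt_const x (t₀ ^ 2 / 2 - t₀ + t₀ * Real.log t₀)).congr_of_eventuallyEq ?_
      filter_upwards [Iio_mem_nhds hlt] with y hy
      rw [max_eq_right (le_of_lt hy)]
    · rw [stepG, if_neg (not_le.2 hgt), stepBid, if_neg (not_le.2 hgt)]
      have := ((((hasDerivAt_id x).pow 2).div_const 2).sub (hasDerivAt_id x)).add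
        ((Real.hasDerivAt_log hx.1.ne').const_mul t₀)
      refine (this.congr_of_eventuallyEq ?_).congr_deriv ?_
      · filter_upwards [Ioi_mem_nhds hgt] with y hy
        simp [max_eq_left (le_of_lt (mem_Ioi.1 hy))]
      · simp
        ring
  · refine (intervalIntegrable_sub_bidOf_mul (monotone_stepG t₀) (stepG_mem t₀)).congr_ae ?_
    rw [uIoc_of_le zero_le_one]
    refine (ae_restrict_iff' measurableSet_Ioc).2 (.of_forall fun x hx => ?_)
    simp only [bidOf_stepG h0.le hx.1]

theorem objective_stepG {t₀ : ℝ} (h0 : 0 < t₀) (h1 : t₀ < 1) (h : t₀ = -Real.log t₀) :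
    objective (stepG t₀) = t₀ + t₀ ^ 2 / 2 - 1 / 2 := by
  rw [objective_eq fun x _ => stepG_mem t₀ x, ← sub_stepBid_mul_integral h0 h1 h]
  refine intervalIntegral.integral_congr_ae (.of_forall fun x hx => ?_)
  rw [uIoc_of_le zero_le_one] at hx
  simp only [bidOf_stepG h0.le hx.1]

/-! ### The follower's problem -/

section Follower

theorem followerWin_nonneg (s : Kernel ℝ ℝ) (t : ℝ) : 0 ≤ followerWin s t := measureReal_nonneg

theorem followerUtility_eq_of_mem {s : Kernel ℝ ℝ} {y t : ℝ} (ht : t ∈ bestResponses s y) :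
    followerUtility s y = followerPayoff s y t :=
  IsGreatest.csSup_eq ⟨mem_image_of_mem _ ht.1, by rintro _ ⟨t', ht', rfl⟩; exact ht.2 t' ht'⟩

variable (s : Kernel ℝ ℝ) [IsMarkovKernel s]

theorem followerWin_eq_cdf (t : ℝ) : followerWin s t = cdf (typeLaw.bind s) t :=
  (cdf_eq_real _ _).symm

theorem followerWin_le_one (t : ℝ) : followerWin s t ≤ 1 := measureReal_le_one

theorem monotone_followerWin : Monotone (followerWin s) := fun a b hab => by
  simpa only [followerWin_eq_cdf] using monotone_cdf _ hab

theorem followerWin_rightCont (t : ℝ) : ContinuousWithinAt (followerWin s) (Ici t) t := by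
  have : followerWin s = cdf (typeLaw.bind s) := funext (followerWin_eq_cdf s)
  rw [this]
  exact StieltjesFunction.right_continuous _ t

theorem continuousAt_followerWin_max (t : ℝ) :
    ContinuousAt (fun z => followerWin s (max z t)) t := by
  have h1 : Tendsto (fun z => max z t) (𝓝 t) (𝓝[Ici t] t) := by
    refine tendsto_nhdsWithin_iff.2 ⟨?_, .of_forall fun z => le_max_right z t⟩
    exact (continuous_id.max continuous_const).tendsto' t t (max_self t)
  have h2 := (followerWin_rightCont s t).tendsto.comp h1
  simpa [ContinuousAt, max_self, Function.comp_def] using h2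

variable {s}

theorem exists_mem_bestResponses {y : ℝ} (hy : 0 ≤ y) : ∃ t ∈ bestResponses s y, t ≤ y := by
  -- The winning probability is only right continuous, but it is dominated by its value at `max z
  -- t`, which is continuous in z at t. Bids above y cannot help, so compactness of [0, y] suffices.
  have husc : UpperSemicontinuousOn (followerPayoff s y) (Icc 0 y) := by
    intro t _ c hc
    have hcont : ContinuousAt (fun z => (y - z) * followerWin s (max z t)) t :=
      (by fun_prop : ContinuousAt (fun z => y - z) t).mul (continuousAt_followerWin_max s t)
    have hev : ∀ᶠ z in 𝓝 t, (y - z) * followerWin s (max z t) < c :=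
      hcont.eventually (gt_mem_nhds (by simpa [followerPayoff] using hc))
    filter_upwards [hev.filter_mono nhdsWithin_le_nhds, self_mem_nhdsWithin] with z hz hzy
    exact (mul_le_mul_of_nonneg_left (monotone_followerWin s (le_max_left z t))
      (sub_nonneg.2 hzy.2)).trans_lt hz
  obtain ⟨t, ht, hmax⟩ := husc.exists_isMaxOn (nonempty_Icc.2 hy) isCompact_Icc
  refine ⟨t, ⟨ht.1, fun t' ht' => ?_⟩, ht.2⟩
  rcases le_total t' y with h | h
  · exact hmax ⟨ht', h⟩
  · have h1 : followerPayoff s y t' ≤ 0 :=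
      mul_nonpos_of_nonpos_of_nonneg (sub_nonpos.2 h) (followerWin_nonneg s t')
    exact h1.trans (mul_nonneg (sub_nonneg.2 ht.2) (followerWin_nonneg s t))

/-- Right continuity of the winning probability, due to ties going to the follower, keeps the
infimum of the best responses a best response. -/
theorem isLeast_response {y : ℝ} (hy : 0 ≤ y) :
    IsLeast (bestResponses s y) (response s y) := by
  obtain ⟨t₁, ht₁, -⟩ := exists_mem_bestResponses (s := s) hy
  have hne : (bestResponses s y).Nonempty := ⟨t₁, ht₁⟩
  have hbdd : BddBelow (bestResponses s y) := ⟨0, fun t ht => ht.1⟩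
  have hlow : ∀ t ∈ bestResponses s y, response s y ≤ t := fun t ht => csInf_le hbdd ht
  refine ⟨⟨le_csInf hne fun t ht => ht.1, fun t' ht' => ?_⟩, fun t ht => hlow t ht⟩
  refine (ht₁.2 t' ht').trans ?_
  have hcont : ContinuousWithinAt (followerPayoff s y) (Ici (response s y)) (response s y) :=
    (by fun_prop : ContinuousWithinAt (fun z => y - z) _ _).mul (followerWin_rightCont s _)
  by_contra! hlt
  have hev : ∀ᶠ z in 𝓝[≥] (response s y), followerPayoff s y z < followerPayoff s y t₁ :=
    hcont.eventually (gt_mem_nhds hlt)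
  obtain ⟨c, hc, hsub⟩ := mem_nhdsGE_iff_exists_Ico_subset.1 hev
  obtain ⟨z, hz, hzc⟩ := exists_lt_of_csInf_lt hne hc
  exact absurd (hz.2 t₁ ht₁.1) (not_le.2 (hsub ⟨hlow z hz, hzc⟩))

theorem response_nonneg {y : ℝ} (hy : 0 ≤ y) : 0 ≤ response s y := (isLeast_response hy).1.1

theorem response_le {y : ℝ} (hy : 0 ≤ y) : response s y ≤ y := by
  obtain ⟨t, ht, hty⟩ := exists_mem_bestResponses (s := s) hy
  exact ((isLeast_response hy).2 ht).trans hty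

theorem followerUtility_eq {y : ℝ} (hy : 0 ≤ y) :
    followerUtility s y = followerPayoff s y (response s y) :=
  followerUtility_eq_of_mem (isLeast_response hy).1

theorem followerPayoff_le_utility {y t : ℝ} (hy : 0 ≤ y) (ht : 0 ≤ t) :
    followerPayoff s y t ≤ followerUtility s y := by
  rw [followerUtility_eq hy]
  exact (isLeast_response hy).1.2 t ht

theorem followerUtility_nonneg {y : ℝ} (hy : 0 ≤ y) : 0 ≤ followerUtility s y := by
  simpa [followerPayoff] using followerPayoff_le_utility (s := s) hy hy

theorem followerUtility_zero : followerUtility s 0 = 0 := by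
  have h : response s 0 = 0 := le_antisymm (response_le le_rfl) (response_nonneg le_rfl)
  rw [followerUtility_eq le_rfl, h]
  simp [followerPayoff]

variable (s) in
/-- The follower's probability of winning, as a function of her type. -/
noncomputable def responseWin (y : ℝ) : ℝ := followerWin s (response s y)

theorem responseWin_nonneg (s : Kernel ℝ ℝ) (y : ℝ) : 0 ≤ responseWin s y := followerWin_nonneg _ _

theorem responseWin_le_one (y : ℝ) : responseWin s y ≤ 1 := followerWin_le_one _ _

/-- Type y may imitate the bid of type y'. This is the subgradient inequality for the follower's
utility. -/
theorem followerUtility_sub_le {y y' : ℝ} (hy : 0 ≤ y) (hy' : 0 ≤ y') :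
    followerUtility s y' - followerUtility s y ≤ (y' - y) * responseWin s y' := by
  have h := followerPayoff_le_utility (s := s) hy (response_nonneg (s := s) hy')
  rw [followerUtility_eq hy']
  unfold followerPayoff responseWin at *
  linarith

theorem monotoneOn_followerUtility : MonotoneOn (followerUtility s) (Ici 0) := fun y hy y' hy' h => by
  have h1 := followerUtility_sub_le (s := s) hy' hy
  have h2 := mul_nonneg (sub_nonneg.2 h) (responseWin_nonneg s y)
  linarith

theorem followerUtility_le {y : ℝ} (hy : 0 ≤ y) : followerUtility s y ≤ y := by
  have h1 := followerUtility_sub_le (s := s) le_rfl hy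
  rw [followerUtility_zero] at h1
  nlinarith [responseWin_le_one (s := s) y]

/-- Single crossing: a higher type gains more from a higher winning probability. Choosing the lowest
best response makes the lower type's preference strict, which yields the contradiction. -/
theorem monotoneOn_response : MonotoneOn (response s) (Ici 0) := by
  intro y hy y' hy' hle
  rcases hle.eq_or_lt with rfl | hlt
  · exact le_rfl
  by_contra! hr
  have h1 := (isLeast_response (s := s) hy').1.2 _ (response_nonneg (s := s) hy)
  have h2 : followerPayoff s y (response s y') < followerPayoff s y (response s y) := by
    by_contra! hge
    refine absurd ((isLeast_response (s := s) hy).2 ⟨response_nonneg hy', fun t ht => ?_⟩)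
      (not_le.2 hr)
    exact ((isLeast_response (s := s) hy).1.2 t ht).trans hge
  have h3 := mul_le_mul_of_nonneg_left (monotone_followerWin s hr.le) (sub_nonneg.2 hle)
  unfold followerPayoff at h1 h2
  linarith

theorem monotoneOn_responseWin : MonotoneOn (responseWin s) (Ici 0) := fun _ hy _ hy' h =>
  monotone_followerWin s (monotoneOn_response hy hy' h)

end Follower

/-! ### The equal-bid function induced by a strategy -/

/-- For monotone q the set where q < c is an initial segment of the types, so its mass locates its
right end. -/
theorem lt_of_lt_typeLaw_real {q : ℝ → ℝ} (hq : MonotoneOn q (Icc 0 1)) {c y : ℝ}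
    (hy : y ∈ Icc (0 : ℝ) 1) (h : y < typeLaw.real {z | q z < c}) : q y < c := by
  by_contra! hc
  refine absurd h (not_lt.2 ?_)
  calc typeLaw.real {z | q z < c} ≤ typeLaw.real (Iic y) := by
        refine ENNReal.toReal_mono (measure_ne_top _ _) (measure_mono_ae ?_)
        refine ae_typeLaw_of_forall fun z hz hzc => ?_
        by_contra hyz
        exact absurd (hq hy ⟨hz.1.le, hz.2.le⟩ (le_of_lt (not_le.1 hyz)))
          (not_le.2 (lt_of_lt_of_le hzc hc))
    _ = y := typeLaw_real_Iic hy

theorem le_of_typeLaw_real_lt {q : ℝ → ℝ} (hq : MonotoneOn q (Icc 0 1)) {c y : ℝ}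
    (hy : y ∈ Icc (0 : ℝ) 1) (h : typeLaw.real {z | q z < c} < y) : c ≤ q y := by
  by_contra! hc
  refine absurd h (not_lt.2 ?_)
  calc y = typeLaw.real (Iic y) := (typeLaw_real_Iic hy).symm
    _ ≤ typeLaw.real {z | q z < c} := by
        refine ENNReal.toReal_mono (measure_ne_top _ _) (measure_mono_ae ?_)
        refine ae_typeLaw_of_forall fun z hz hzy => ?_
        exact (hq ⟨hz.1.le, hz.2.le⟩ hy hzy).trans_lt hc

/-- The mass of the follower types that win with probability less than `x`. -/
noncomputable def losingShare (s : Kernel ℝ ℝ) (x : ℝ) : ℝ := typeLaw.real {y | responseWin s y < x}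

theorem monotone_losingShare (s : Kernel ℝ ℝ) : Monotone (losingShare s) := fun _ _ h =>
  measureReal_mono fun _ hy => lt_of_lt_of_le hy h

theorem losingShare_mem (s : Kernel ℝ ℝ) (x : ℝ) : losingShare s x ∈ Icc (0 : ℝ) 1 :=
  ⟨measureReal_nonneg, measureReal_le_one⟩

section Conjugate

variable {s : Kernel ℝ ℝ} [IsMarkovKernel s]

theorem losingShare_zero (s : Kernel ℝ ℝ) : losingShare s 0 = 0 := by
  have : {y | responseWin s y < 0} = ∅ :=
    eq_empty_of_forall_notMem fun y hy => absurd hy (not_lt.2 (responseWin_nonneg s y))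
  rw [losingShare, this, measureReal_empty]

/-- The supremum defining the convex conjugate of the follower's utility at `x` is attained at
`losingShare s x`. -/
theorem mul_sub_followerUtility_le {x y : ℝ} (hx : x ∈ Icc (0 : ℝ) 1) (hy : y ∈ Icc (0 : ℝ) 1) :
    x * y - followerUtility s y ≤
      x * losingShare s x - followerUtility s (losingShare s x) := by
  have hq : MonotoneOn (responseWin s) (Icc 0 1) :=
    monotoneOn_responseWin.mono fun z hz => hz.1
  have hh := losingShare_mem s x
  set h := losingShare s x with hdef
  by_contra! hlt
  -- The value of `responseWin` at h itself is not controlled: it is < x before h and ≥ x after h.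
  -- So the comparison goes through a point z between y and h, at distance less than the gap δ from
  -- h; the piece between z and h costs less than δ because slopes lie in [0,1].
  rcases lt_trichotomy y h with hyh | rfl | hyh
  · set δ := x * y - followerUtility s y - (x * h - followerUtility s h) with hδ
    have hδ0 : 0 < δ := sub_pos.2 hlt
    obtain ⟨z, hz1, hz2⟩ := exists_between (max_lt hyh (sub_lt_self h hδ0))
    have hyz := (le_max_left _ _).trans_lt hz1
    have hδz := (le_max_right _ _).trans_lt hz1
    have hz : z ∈ Icc (0 : ℝ) 1 := ⟨hy.1.trans hyz.le, hz2.le.trans hh.2⟩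
    have h1 := followerUtility_sub_le (s := s) hy.1 hz.1
    have h2 := followerUtility_sub_le (s := s) hz.1 hh.1
    have h3 := mul_le_mul_of_nonneg_left (lt_of_lt_typeLaw_real hq hz hz2).le (sub_pos.2 hyz).le
    have h4 := mul_le_mul_of_nonneg_left (responseWin_le_one (s := s) h) (sub_pos.2 hz2).le
    have h5 := mul_nonneg hx.1 (sub_pos.2 hz2).le
    linarith
  · exact lt_irrefl _ hlt
  · set δ := x * y - followerUtility s y - (x * h - followerUtility s h) with hδ
    have hδ0 : 0 < δ := sub_pos.2 hlt
    obtain ⟨z, hz1, hz2⟩ := exists_between (lt_min hyh (lt_add_of_pos_right h hδ0))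
    have hyz := hz2.trans_le (min_le_left _ _)
    have hδz := hz2.trans_le (min_le_right _ _)
    have hz : z ∈ Icc (0 : ℝ) 1 := ⟨hh.1.trans hz1.le, hyz.le.trans hy.2⟩
    have h1 := followerUtility_sub_le (s := s) hy.1 hz.1
    have h2 := monotoneOn_followerUtility (s := s) hh.1 hz.1 hz1.le
    have h3 := mul_le_mul_of_nonneg_left (le_of_typeLaw_real_lt hq hz hz1) (sub_pos.2 hyz).le
    have h5 := mul_nonneg (sub_nonneg.2 hx.2) (sub_pos.2 hz1).le
    linarith

/-- A function with a monotone bounded selection of subgradients is its primitive. -/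
theorem integral_eq_of_subgradient {g φ : ℝ → ℝ} (hm : Monotone g)
    (hg : ∀ x, g x ∈ Icc (0 : ℝ) 1)
    (hsub : ∀ a ∈ Icc (0 : ℝ) 1, ∀ b ∈ Icc (0 : ℝ) 1, φ a + (b - a) * g a ≤ φ b)
    {x : ℝ} (hx : x ∈ Icc (0 : ℝ) 1) : ∫ t in (0 : ℝ)..x, g t = φ x - φ 0 := by
  refine integral_eq_of_hasDerivAt_off_countable φ g hm.countable_not_continuousAt ?_ ?_
    hm.intervalIntegrable
  · rw [uIcc_of_le hx.1]
    refine ContinuousOn.mono ?_ (Icc_subset_Icc_right hx.2)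
    refine LipschitzOnWith.continuousOn (K := 1) (LipschitzOnWith.of_dist_le_mul fun a ha b hb => ?_)
    rw [NNReal.coe_one, one_mul, Real.dist_eq, Real.dist_eq]
    have h1 := hsub a ha b hb
    have h2 := hsub b hb a ha
    have ha' := hg a
    have hb' := hg b
    rcases le_total a b with h | h
    · rw [abs_sub_comm a b, abs_of_nonneg (sub_nonneg.2 h), abs_le]
      constructor <;> nlinarith [ha'.1, ha'.2, hb'.1, hb'.2]
    · rw [abs_of_nonneg (sub_nonneg.2 h), abs_le]
      constructor <;> nlinarith [ha'.1, ha'.2, hb'.1, hb'.2]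
  · rintro c ⟨hc, hcont⟩
    rw [min_eq_left hx.1, max_eq_right hx.1] at hc
    simp only [mem_ofPred_eq, not_not] at hcont
    have hc' : c ∈ Icc (0 : ℝ) 1 := ⟨hc.1.le, hc.2.le.trans hx.2⟩
    rw [hasDerivAt_iff_isLittleO, Asymptotics.isLittleO_iff]
    intro ε hε
    filter_upwards [Icc_mem_nhds hc.1 (hc.2.trans_le hx.2),
      hcont.eventually (Metric.ball_mem_nhds (g c) hε)] with b hb hbε
    rw [Real.dist_eq] at hbε
    have h1 := hsub c hc' b hb
    have h2 := hsub b hb c hc'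
    rw [smul_eq_mul, Real.norm_eq_abs, Real.norm_eq_abs, abs_of_nonneg (by linarith)]
    calc φ b - φ c - (b - c) * g c ≤ (g b - g c) * (b - c) := by linarith
      _ ≤ |g b - g c| * |b - c| := (le_abs_self _).trans (abs_mul _ _).le
      _ ≤ ε * |b - c| := by gcongr

theorem integral_losingShare {x : ℝ} (hx : x ∈ Icc (0 : ℝ) 1) :
    ∫ t in (0 : ℝ)..x, losingShare s t =
      x * losingShare s x - followerUtility s (losingShare s x) := by
  rw [integral_eq_of_subgradient (φ := fun x => x * losingShare s x -
    followerUtility s (losingShare s x)) (monotone_losingShare s) (losingShare_mem s) ?_ hx]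
  · simp [losingShare_zero s, followerUtility_zero]
  · intro a ha b hb
    have := mul_sub_followerUtility_le (s := s) hb (losingShare_mem s a)
    linarith

end Conjugate

/-! ### The quantile function of the leader's bid -/

/-- The quantile function of the leader's bid. -/
noncomputable def bidQuantile (s : Kernel ℝ ℝ) (x : ℝ) : ℝ := sInf {t | x ≤ followerWin s t}

theorem monotone_leaderWin (s : Kernel ℝ ℝ) : Monotone (leaderWin s) := fun _ _ h =>
  measureReal_mono fun _ hy => lt_of_lt_of_le hy h

theorem leaderWin_mem (s : Kernel ℝ ℝ) (b : ℝ) : leaderWin s b ∈ Icc (0 : ℝ) 1 :=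
  ⟨measureReal_nonneg, measureReal_le_one⟩

theorem measurable_leaderPayoff (s : Kernel ℝ ℝ) : Measurable (leaderPayoff s) :=
  (measurable_fst.sub measurable_snd).mul ((monotone_leaderWin s).measurable.comp measurable_snd)

section Quantile

variable {s : Kernel ℝ ℝ} [IsMarkovKernel s]

/-- Right continuity of the distribution function makes the infimum attained. For x in (0,1) the set
is nonempty and bounded below, so `sInf` takes no default value. -/
theorem bidQuantile_le_iff {x : ℝ} (hx : x ∈ Ioo (0 : ℝ) 1) (t : ℝ) :
    bidQuantile s x ≤ t ↔ x ≤ followerWin s t := by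
  have hF : followerWin s = cdf (typeLaw.bind s) := funext (followerWin_eq_cdf s)
  have htop : Tendsto (followerWin s) atTop (𝓝 1) := hF ▸ tendsto_cdf_atTop _
  have hbot : Tendsto (followerWin s) atBot (𝓝 0) := hF ▸ tendsto_cdf_atBot _
  obtain ⟨t₁, ht₁⟩ := (htop.eventually (lt_mem_nhds hx.2)).exists
  obtain ⟨t₂, ht₂⟩ := (hbot.eventually (gt_mem_nhds hx.1)).exists
  have hne : {t | x ≤ followerWin s t}.Nonempty := ⟨t₁, ht₁.le⟩
  have hbdd : BddBelow {t | x ≤ followerWin s t} := ⟨t₂, fun t ht => by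
    by_contra! hlt
    exact absurd (monotone_followerWin s hlt.le) (not_le.2 (ht₂.trans_le ht))⟩
  refine ⟨fun h => ?_, fun h => csInf_le hbdd h⟩
  by_contra! hlt
  obtain ⟨c, hc, hsub⟩ := mem_nhdsGE_iff_exists_Ico_subset.1
    ((followerWin_rightCont s t).eventually (gt_mem_nhds hlt))
  obtain ⟨z, hz, hzc⟩ := exists_lt_of_csInf_lt hne (h.trans_lt hc)
  change x ≤ followerWin s z at hz
  rcases le_total t z with htz | hzt
  · exact absurd hz (not_le.2 (hsub ⟨htz, hzc⟩))
  · exact absurd (hz.trans (monotone_followerWin s hzt)) (not_le.2 hlt)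

theorem aemeasurable_bidQuantile : AEMeasurable (bidQuantile s) typeLaw := by
  rw [typeLaw, ← restrict_Ioo_eq_restrict_Icc]
  refine aemeasurable_restrict_of_monotoneOn measurableSet_Ioo fun a ha b hb hab => ?_
  rw [bidQuantile_le_iff ha]
  exact hab.trans ((bidQuantile_le_iff hb _).1 le_rfl)

theorem map_bidQuantile : typeLaw.map (bidQuantile s) = typeLaw.bind s := by
  have := Measure.isProbabilityMeasure_map (aemeasurable_bidQuantile (s := s))
  refine Measure.eq_of_cdf _ _ (StieltjesFunction.ext fun t => ?_)
  rw [← followerWin_eq_cdf, cdf_eq_real, measureReal_def,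
    Measure.map_apply_of_aemeasurable aemeasurable_bidQuantile measurableSet_Iic,
    ← typeLaw_real_Iic ⟨followerWin_nonneg s t, followerWin_le_one s t⟩, measureReal_def]
  congr 1
  refine measure_congr ?_
  filter_upwards [ae_typeLaw_of_forall fun x hx => bidQuantile_le_iff (s := s) hx t] with x hx
  exact propext hx

theorem leaderWin_bidQuantile {x : ℝ} (hx : x ∈ Ioo (0 : ℝ) 1) :
    leaderWin s (bidQuantile s x) = losingShare s x := by
  unfold leaderWin losingShare responseWin
  congr 1
  ext y
  simp only [mem_ofPred_eq]
  rw [← not_le, bidQuantile_le_iff hx, not_le]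

theorem leaderWin_of_nonpos {b : ℝ} (hb : b ≤ 0) : leaderWin s b = 0 := by
  rw [leaderWin, measureReal_def, ENNReal.toReal_eq_zero_iff]
  refine .inl (measure_mono_null (t := {y | ¬(0 ≤ response s y)}) (fun y hy => ?_) ?_)
  · exact not_le.2 (lt_of_lt_of_le hy hb)
  · exact ae_typeLaw_of_forall fun y hy => response_nonneg hy.1.le

/-- The follower of type h(x) can bid the quantile and win with probability at least x, which bounds
her utility from below. The factor `losingShare` disposes of negative quantiles: such bids never
win. -/
theorem bidOf_losingShare_mul_le {x : ℝ} (hx : x ∈ Ioo (0 : ℝ) 1) :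
    bidOf (losingShare s) x * losingShare s x ≤ bidQuantile s x * losingShare s x := by
  rcases lt_or_ge (bidQuantile s x) 0 with hb | hb
  · simp [← leaderWin_bidQuantile hx, leaderWin_of_nonpos hb.le]
  have hh := losingShare_mem s x
  refine mul_le_mul_of_nonneg_right ?_ hh.1
  rw [bidOf, integral_losingShare ⟨hx.1.le, hx.2.le⟩, one_div, inv_mul_le_iff₀ hx.1]
  have hF := (bidQuantile_le_iff hx _).1 (le_refl (bidQuantile s x))
  have hle : (losingShare s x - bidQuantile s x) * x ≤ followerUtility s (losingShare s x) := by
    rcases le_total (bidQuantile s x) (losingShare s x) with h | h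
    · exact (mul_le_mul_of_nonneg_left hF (sub_nonneg.2 h)).trans
        (followerPayoff_le_utility hh.1 hb)
    · exact (mul_nonpos_of_nonpos_of_nonneg (sub_nonpos.2 h) hx.1.le).trans
        (followerUtility_nonneg hh.1)
  linarith

/-! ### The upper bound on the leader's utility -/

theorem monotone_followerUtility_comp {k : ℝ → ℝ} (hk : Monotone k)
    (hk' : ∀ x, k x ∈ Icc (0 : ℝ) 1) : Monotone fun x => followerUtility s (k x) := fun a b hab =>
  monotoneOn_followerUtility (hk' a).1 (hk' b).1 (hk hab)

theorem abs_followerUtility_comp_le {k : ℝ → ℝ} (hk' : ∀ x, k x ∈ Icc (0 : ℝ) 1) (x : ℝ) :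
    |followerUtility s (k x)| ≤ 1 := by
  rw [abs_of_nonneg (followerUtility_nonneg (hk' x).1)]
  exact (followerUtility_le (hk' x).1).trans (hk' x).2

theorem ae_fst_mem : ∀ᵐ p ∂(typeLaw ⊗ₘ s), p.1 ∈ Ioo (0 : ℝ) 1 := by
  refine ae_of_ae_map (p := fun x => x ∈ Ioo (0 : ℝ) 1) measurable_fst.aemeasurable ?_
  rw [← Measure.fst, Measure.fst_compProd]
  exact ae_typeLaw_of_forall fun x hx => hx

theorem integrable_fst_mul_leaderWin :
    Integrable (fun p : ℝ × ℝ => p.1 * leaderWin s p.2) (typeLaw ⊗ₘ s) := by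
  refine Integrable.of_bound (Measurable.aestronglyMeasurable
    (measurable_fst.mul ((monotone_leaderWin s).measurable.comp measurable_snd))) 1 ?_
  filter_upwards [ae_fst_mem] with p hp
  have := leaderWin_mem s p.2
  rw [Real.norm_of_nonneg (mul_nonneg hp.1.le this.1)]
  exact mul_le_one₀ hp.2.le this.1 this.2

theorem integrable_mul_losingShare (s : Kernel ℝ ℝ) : Integrable (fun x => x * losingShare s x) typeLaw := by
  refine integrable_typeLaw_of_bound (measurable_id.mul (monotone_losingShare s).measurable) 1
    fun x hx => ?_
  have := losingShare_mem s x
  rw [abs_of_nonneg (mul_nonneg hx.1.le this.1)]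
  exact mul_le_one₀ hx.2 this.1 this.2

/-- Among all joint laws of type and bid with given marginals, the monotone one is best for the
leader. -/
theorem integral_fst_mul_leaderWin_le :
    ∫ p, p.1 * leaderWin s p.2 ∂(typeLaw ⊗ₘ s) ≤ ∫ x, x * losingShare s x ∂typeLaw := by
  set φ : ℝ → ℝ := fun x => x * losingShare s x - followerUtility s (losingShare s x) with hφ
  set v : ℝ → ℝ := fun b => followerUtility s (leaderWin s b) with hv
  have hum := monotone_followerUtility_comp (s := s) (monotone_losingShare s) (losingShare_mem s)
  have hui : Integrable (fun x => followerUtility s (losingShare s x)) typeLaw :=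
    integrable_typeLaw_of_bound hum.measurable 1
      fun x _ => abs_followerUtility_comp_le (losingShare_mem s) x
  have hφi : Integrable φ typeLaw := (integrable_mul_losingShare s).sub hui
  have hvm : Monotone v := monotone_followerUtility_comp (monotone_leaderWin s) (leaderWin_mem s)
  have hfst : (typeLaw ⊗ₘ s).map Prod.fst = typeLaw := by
    rw [← Measure.fst, Measure.fst_compProd]
  have hsnd : (typeLaw ⊗ₘ s).map Prod.snd = typeLaw.map (bidQuantile s) := by
    rw [← Measure.snd, Measure.snd_compProd, map_bidQuantile]
  have hφi' : Integrable (fun p : ℝ × ℝ => φ p.1) (typeLaw ⊗ₘ s) :=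
    Integrable.comp_measurable (by rwa [hfst]) measurable_fst
  have hvi' : Integrable (fun p : ℝ × ℝ => v p.2) (typeLaw ⊗ₘ s) :=
    Integrable.of_bound (hvm.measurable.comp measurable_snd).aestronglyMeasurable 1
      (.of_forall fun p => abs_followerUtility_comp_le (leaderWin_mem s) p.2)
  have hφint : ∫ p, φ p.1 ∂(typeLaw ⊗ₘ s) = ∫ x, φ x ∂typeLaw := by
    conv_rhs => rw [← hfst]
    rw [integral_map measurable_fst.aemeasurable (by rw [hfst]; exact hφi.aestronglyMeasurable)]
  have hvint : ∫ p, v p.2 ∂(typeLaw ⊗ₘ s) =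
      ∫ x, followerUtility s (losingShare s x) ∂typeLaw := by
    rw [← integral_map (f := v) measurable_snd.aemeasurable hvm.measurable.aestronglyMeasurable,
      hsnd, integral_map aemeasurable_bidQuantile hvm.measurable.aestronglyMeasurable]
    refine integral_congr_ae (ae_typeLaw_of_forall fun x hx => ?_)
    simp only [hv, leaderWin_bidQuantile hx]
  -- Fenchel-Young separates type from bid, so each integral depends on one marginal only and can be
  -- evaluated under the monotone coupling, where equality holds.
  calc ∫ p, p.1 * leaderWin s p.2 ∂(typeLaw ⊗ₘ s)
      ≤ ∫ p, φ p.1 + v p.2 ∂(typeLaw ⊗ₘ s) := by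
        refine integral_mono_ae integrable_fst_mul_leaderWin (hφi'.add hvi') ?_
        filter_upwards [ae_fst_mem] with p hp
        have := mul_sub_followerUtility_le (s := s) ⟨hp.1.le, hp.2.le⟩ (leaderWin_mem s p.2)
        simp only [hφ, hv]
        linarith
    _ = ∫ x, φ x + followerUtility s (losingShare s x) ∂typeLaw := by
        rw [integral_add hφi' hvi', hφint, hvint, integral_add hφi hui]
    _ = ∫ x, x * losingShare s x ∂typeLaw := by simp [hφ]

theorem snd_mul_leaderWin (hint : Integrable (leaderPayoff s) (typeLaw ⊗ₘ s)) :
    Integrable (fun p : ℝ × ℝ => p.2 * leaderWin s p.2) (typeLaw ⊗ₘ s) ∧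
    Integrable (fun x => bidQuantile s x * losingShare s x) typeLaw ∧
    ∫ p, p.2 * leaderWin s p.2 ∂(typeLaw ⊗ₘ s) =
      ∫ x, bidQuantile s x * losingShare s x ∂typeLaw := by
  have hsnd : (typeLaw ⊗ₘ s).map Prod.snd = typeLaw.map (bidQuantile s) := by
    rw [← Measure.snd, Measure.snd_compProd, map_bidQuantile]
  have hm : Measurable fun b => b * leaderWin s b :=
    measurable_id.mul (monotone_leaderWin s).measurable
  have h1 : Integrable (fun p : ℝ × ℝ => p.2 * leaderWin s p.2) (typeLaw ⊗ₘ s) := by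
    refine (integrable_fst_mul_leaderWin.sub hint).congr (.of_forall fun p => ?_)
    simp only [leaderPayoff, Pi.sub_apply]
    ring
  have hcongr : (fun x => bidQuantile s x * leaderWin s (bidQuantile s x)) =ᵐ[typeLaw]
      fun x => bidQuantile s x * losingShare s x :=
    ae_typeLaw_of_forall fun x hx => by simp only [leaderWin_bidQuantile hx]
  refine ⟨h1, ?_, ?_⟩
  · have h2 : Integrable (fun b => b * leaderWin s b) ((typeLaw ⊗ₘ s).map Prod.snd) :=
      (integrable_map_measure hm.aestronglyMeasurable measurable_snd.aemeasurable).2 h1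
    rw [hsnd, integrable_map_measure hm.aestronglyMeasurable aemeasurable_bidQuantile] at h2
    exact h2.congr hcongr
  · rw [← integral_map (f := fun b => b * leaderWin s b) measurable_snd.aemeasurable
      hm.aestronglyMeasurable, hsnd, integral_map aemeasurable_bidQuantile hm.aestronglyMeasurable]
    exact integral_congr_ae hcongr

theorem leaderUtility_le_integral (hint : Integrable (leaderPayoff s) (typeLaw ⊗ₘ s)) :
    leaderUtility s ≤ ∫ x, x * losingShare s x ∂typeLaw -
      ∫ x, bidQuantile s x * losingShare s x ∂typeLaw := by
  obtain ⟨h1, -, h3⟩ := snd_mul_leaderWin hint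
  have : leaderUtility s = ∫ p, p.1 * leaderWin s p.2 ∂(typeLaw ⊗ₘ s) -
      ∫ p, p.2 * leaderWin s p.2 ∂(typeLaw ⊗ₘ s) := by
    rw [← integral_sub integrable_fst_mul_leaderWin h1]
    simp only [leaderUtility, leaderPayoff, sub_mul]
  rw [this, h3]
  exact sub_le_sub_right integral_fst_mul_leaderWin_le _

theorem integrable_bidOf_losingShare (s : Kernel ℝ ℝ) :
    Integrable (fun x => bidOf (losingShare s) x * losingShare s x) typeLaw := by
  refine integrable_typeLaw_of_bound ((measurable_bidOf (monotone_losingShare s)).mul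
    (monotone_losingShare s).measurable) 1 fun x hx => ?_
  have h1 := bidOf_mem (monotone_losingShare s) (losingShare_mem s) hx.1
  have h2 := losingShare_mem s x
  rw [abs_of_nonneg (mul_nonneg h1.1 h2.1)]
  exact mul_le_one₀ h1.2 h2.1 h2.2

theorem objective_losingShare (s : Kernel ℝ ℝ) :
    objective (losingShare s) = ∫ x, x * losingShare s x ∂typeLaw -
      ∫ x, bidOf (losingShare s) x * losingShare s x ∂typeLaw := by
  rw [objective_eq fun x _ => losingShare_mem s x, ← integral_typeLaw,
    ← integral_sub (integrable_mul_losingShare s) (integrable_bidOf_losingShare s)]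
  simp only [sub_mul]

theorem integral_bidOf_losingShare_le (hint : Integrable (leaderPayoff s) (typeLaw ⊗ₘ s)) :
    ∫ x, bidOf (losingShare s) x * losingShare s x ∂typeLaw ≤
      ∫ x, bidQuantile s x * losingShare s x ∂typeLaw :=
  integral_mono_ae (integrable_bidOf_losingShare s) (snd_mul_leaderWin hint).2.1
    (ae_typeLaw_of_forall fun _ hx => bidOf_losingShare_mul_le hx)

theorem leaderUtility_le_objective (hint : Integrable (leaderPayoff s) (typeLaw ⊗ₘ s)) :
    leaderUtility s ≤ objective (losingShare s) := by
  rw [objective_losingShare]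
  linarith [leaderUtility_le_integral hint, integral_bidOf_losingShare_le hint]

theorem leaderUtility_le {t₀ : ℝ} (h0 : 0 < t₀) (h1 : t₀ < 1) (h : t₀ = -Real.log t₀)
    (hpos : 0 ≤ objective (stepG t₀)) : leaderUtility s ≤ objective (stepG t₀) := by
  by_cases hint : Integrable (leaderPayoff s) (typeLaw ⊗ₘ s)
  · exact (leaderUtility_le_objective hint).trans
      (objective_le_of_monotone h0 h1 h (monotone_losingShare s) (losingShare_mem s))
  -- A non-integrable payoff has integral 0 by default; hence the hypothesis `hpos`.
  · rwa [leaderUtility, integral_undef hint]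

/-- Against an optimal commitment the quantile function of the bid is determined above the
threshold. -/
theorem bidQuantile_eq_of_optimal {t₀ : ℝ} (h0 : 0 < t₀) (h1 : t₀ < 1) (h : t₀ = -Real.log t₀)
    (hpos : 0 < objective (stepG t₀)) (hopt : leaderUtility s = objective (stepG t₀)) :
    ∀ᵐ x ∂typeLaw, t₀ < x → bidQuantile s x = stepBid t₀ x := by
  have hint : Integrable (leaderPayoff s) (typeLaw ⊗ₘ s) := by
    by_contra hni
    rw [leaderUtility, integral_undef hni] at hopt
    exact hpos.ne hopt
  have hle := objective_le_of_monotone h0 h1 h (monotone_losingShare s) (losingShare_mem s)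
  have hobj := objective_losingShare s
  have hU := leaderUtility_le_integral hint
  have hB := integral_bidOf_losingShare_le hint
  have hae := ae_eq_stepG_of_objective_eq h0 h1 h (monotone_losingShare s) (losingShare_mem s)
    (by linarith)
  have heq : ∫ x, bidOf (losingShare s) x * losingShare s x ∂typeLaw =
      ∫ x, bidQuantile s x * losingShare s x ∂typeLaw := by linarith
  rw [integral_eq_iff_of_ae_le (integrable_bidOf_losingShare s) (snd_mul_leaderWin hint).2.1
    (ae_typeLaw_of_forall fun _ hx => bidOf_losingShare_mul_le hx)] at heq
  filter_upwards [heq, hae, ae_typeLaw_of_forall fun x hx => hx] with x hx hxe hxm hlt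
  -- Equality of payments determines the quantile only where `losingShare` is nonzero, hence the
  -- restriction to types above t₀.
  have hone : losingShare s x = 1 := by rw [hxe, stepG, if_neg (not_le.2 hlt)]
  rw [hone, mul_one, mul_one] at hx
  rw [← hx, ← bidOf_stepG h0.le hxm.1, bidOf, bidOf]
  congr 1
  refine intervalIntegral.integral_congr_ae_restrict ?_
  rw [uIoc_of_le hxm.1.le]
  rw [typeLaw_eq_Ioc] at hae
  exact ae_restrict_of_ae_restrict_of_subset (Ioc_subset_Ioc_right hxm.2.le) hae

end Quantile

/-! ### Pure strategies -/

section Pure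

variable {f : ℝ → ℝ} (hf : Measurable f)

theorem followerWin_pureStrategy (t : ℝ) :
    followerWin (pureStrategy f hf) t = typeLaw.real {x | f x ≤ t} := by
  rw [followerWin, pureStrategy, Measure.deterministic_comp_eq_map, measureReal_def,
    Measure.map_apply hf measurableSet_Iic, measureReal_def]
  rfl

theorem compProd_pureStrategy :
    typeLaw ⊗ₘ pureStrategy f hf = typeLaw.map fun x => (x, f x) :=
  Measure.compProd_deterministic hf

theorem le_followerWin_pureStrategy (hmono : MonotoneOn f (Icc 0 1)) {x : ℝ}
    (hx : x ∈ Icc (0 : ℝ) 1) : x ≤ followerWin (pureStrategy f hf) (f x) := by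
  rw [followerWin_pureStrategy]
  calc x = typeLaw.real (Iic x) := (typeLaw_real_Iic hx).symm
    _ ≤ typeLaw.real {z | f z ≤ f x} := by
        refine ENNReal.toReal_mono (measure_ne_top _ _) (measure_mono_ae ?_)
        exact ae_typeLaw_of_forall fun z hz hzx => hmono ⟨hz.1.le, hz.2.le⟩ hx hzx

theorem followerWin_pureStrategy_le (hmono : MonotoneOn f (Icc 0 1)) {x t : ℝ}
    (hx : x ∈ Icc (0 : ℝ) 1) (ht : t < f x) : followerWin (pureStrategy f hf) t ≤ x := by
  rw [followerWin_pureStrategy]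
  calc typeLaw.real {z | f z ≤ t} ≤ typeLaw.real (Iic x) := by
        refine ENNReal.toReal_mono (measure_ne_top _ _) (measure_mono_ae ?_)
        refine ae_typeLaw_of_forall fun z hz hzt => ?_
        by_contra hzx
        exact absurd (hmono hx ⟨hz.1.le, hz.2.le⟩ (le_of_lt (not_le.1 hzx)))
          (not_le.2 (lt_of_le_of_lt hzt ht))
    _ = x := typeLaw_real_Iic hx

theorem bidQuantile_pureStrategy_le (hmono : MonotoneOn f (Icc 0 1)) {x : ℝ}
    (hx : x ∈ Ioo (0 : ℝ) 1) : bidQuantile (pureStrategy f hf) x ≤ f x :=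
  (bidQuantile_le_iff hx _).2 (le_followerWin_pureStrategy hf hmono ⟨hx.1.le, hx.2.le⟩)

theorem le_bidQuantile_pureStrategy (hmono : MonotoneOn f (Icc 0 1)) {x z : ℝ} (hx : 0 ≤ x)
    (hxz : x < z) (hz : z < 1) : f x ≤ bidQuantile (pureStrategy f hf) z := by
  by_contra! hlt
  have h1 := (bidQuantile_le_iff (s := pureStrategy f hf) ⟨hx.trans_lt hxz, hz⟩ _).1 le_rfl
  have h2 := followerWin_pureStrategy_le hf hmono ⟨hx, hxz.le.trans hz.le⟩ hlt
  linarith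

end Pure

theorem exists_mem_Ioo_of_ae {P : ℝ → Prop} (h : ∀ᵐ x ∂typeLaw, P x) {a b : ℝ} (ha : 0 ≤ a)
    (hab : a < b) (hb : b ≤ 1) : ∃ x ∈ Ioo a b, P x := by
  by_contra! hcon
  rw [typeLaw, ae_restrict_iff' measurableSet_Icc] at h
  have hsub : Ioo a b ⊆ {x | ¬(x ∈ Icc (0 : ℝ) 1 → P x)} := fun x hx hx' =>
    hcon x hx (hx' ⟨ha.trans hx.1.le, hx.2.le.trans hb⟩)
  have := measure_mono_null hsub h
  rw [Real.volume_Ioo, ENNReal.ofReal_eq_zero] at this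
  linarith

theorem eq_stepBid_of_optimal {t₀ : ℝ} (h0 : 0 < t₀) (h1 : t₀ < 1) (h : t₀ = -Real.log t₀)
    (hpos : 0 < objective (stepG t₀)) {f : ℝ → ℝ} (hf : Measurable f)
    (hmono : MonotoneOn f (Icc 0 1)) (hnn : ∀ x ∈ Icc (0 : ℝ) 1, 0 ≤ f x)
    (hopt : leaderUtility (pureStrategy f hf) = objective (stepG t₀)) {x : ℝ}
    (hx : x ∈ Ico (0 : ℝ) 1) : f x = stepBid t₀ x := by
  have hae := bidQuantile_eq_of_optimal h0 h1 h hpos hopt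
  have hcont : ∀ m : ℝ, 0 < m → ContinuousAt (fun z => max (z - t₀) 0 / z) m := fun m hm =>
    ContinuousAt.div (by fun_prop) continuousAt_id hm.ne'
  have hx' : x ∈ Icc (0 : ℝ) 1 := ⟨hx.1, hx.2.le⟩
  have hm0 : 0 < max x t₀ := h0.trans_le (le_max_right _ _)
  have hm1 : max x t₀ < 1 := max_lt hx.2 h1
  have hval : stepBid t₀ x = max (max x t₀ - t₀) 0 / max x t₀ := by
    rcases le_total x t₀ with hxt | hxt
    · simp [stepBid, hxt]
    · rw [max_eq_left hxt]
      exact stepBid_eq (h0.trans_le hxt)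
  -- Monotonicity sandwiches f between quantiles: f x ≤ Q(z) for z > x and Q(z) ≤ f z ≤ f x for z <
  -- x. Letting z tend to `max x t₀` from the right, or to x from the left if x > t₀, gives both
  -- bounds; below t₀ nonnegativity replaces the second.
  refine le_antisymm ?_ ?_
  · by_contra! hlt
    rw [hval] at hlt
    have hev : ∀ᶠ z in 𝓝[>] (max x t₀), max (z - t₀) 0 / z < f x :=
      ((hcont _ hm0).eventually (gt_mem_nhds hlt)).filter_mono nhdsWithin_le_nhds
    obtain ⟨c, hc, hsub⟩ := (mem_nhdsGT_iff_exists_Ioo_subset' hm1).1 hev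
    obtain ⟨z, hz, hzb⟩ := exists_mem_Ioo_of_ae hae hm0.le (lt_min hc hm1) (min_le_right c 1)
    have hz1 : z < 1 := hz.2.trans_le (min_le_right _ _)
    have hzt : t₀ < z := (le_max_right _ _).trans_lt hz.1
    have h2 := le_bidQuantile_pureStrategy hf hmono hx.1 ((le_max_left _ _).trans_lt hz.1) hz1
    rw [hzb hzt, stepBid_eq (h0.trans hzt)] at h2
    exact absurd h2 (not_le.2 (hsub ⟨hz.1, hz.2.trans_le (min_le_left _ _)⟩))
  · rcases le_or_gt x t₀ with hxt | hxt
    · rw [stepBid, if_pos hxt]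
      exact hnn x hx'
    by_contra! hlt
    rw [stepBid_eq (h0.trans hxt)] at hlt
    have hev : ∀ᶠ z in 𝓝[<] x, f x < max (z - t₀) 0 / z :=
      ((hcont _ (h0.trans hxt)).eventually (lt_mem_nhds hlt)).filter_mono nhdsWithin_le_nhds
    obtain ⟨c, hc, hsub⟩ := (mem_nhdsLT_iff_exists_Ioo_subset' hxt).1 hev
    obtain ⟨z, hz, hzb⟩ := exists_mem_Ioo_of_ae hae (h0.le.trans (le_max_right c t₀))
      (max_lt hc hxt) hx.2.le
    have hzt : t₀ < z := (le_max_right _ _).trans_lt hz.1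
    have hz01 : z ∈ Ioo (0 : ℝ) 1 := ⟨h0.trans hzt, hz.2.trans hx.2⟩
    have h2 := bidQuantile_pureStrategy_le hf hmono hz01
    rw [hzb hzt, stepBid_eq hz01.1] at h2
    exact absurd (h2.trans (hmono ⟨hz01.1.le, hz01.2.le⟩ hx' hz.2.le))
      (not_le.2 (hsub ⟨(le_max_left _ _).trans_lt hz.1, hz.2⟩))

/-! ### The optimal commitment -/

instance (t₀ : ℝ) : IsMarkovKernel (stepStrategy t₀) := by
  unfold stepStrategy
  infer_instance

section Step

variable {t₀ : ℝ}

theorem followerWin_stepStrategy_zero (h0 : 0 < t₀) (h1 : t₀ < 1) :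
    followerWin (stepStrategy t₀) 0 = t₀ := by
  rw [stepStrategy, followerWin_pureStrategy]
  conv_rhs => rw [← typeLaw_real_Iic (c := t₀) ⟨h0.le, h1.le⟩]
  refine measureReal_congr ?_
  filter_upwards [ae_typeLaw_of_forall fun x hx => hx] with x hx
  refine propext (show stepBid t₀ x ≤ 0 ↔ x ≤ t₀ from ?_)
  unfold stepBid
  split_ifs with h
  · simp [h]
  · simp only [h, iff_false, not_le, sub_pos]
    rw [div_lt_one hx.1]
    exact not_le.1 h

/-- The follower of type 1 gets at most t₀ from any bid below 1, because 1 - t₀/x ≤ t means x ≤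
t₀/(1 - t). Lower types lose more by raising their bids, so 0 is a best response for everyone. -/
theorem followerWin_stepStrategy_mul_le (h0 : 0 < t₀) {t : ℝ} (ht1 : t < 1) :
    followerWin (stepStrategy t₀) t * (1 - t) ≤ t₀ := by
  have h1t : 0 < 1 - t := sub_pos.2 ht1
  rcases le_total (1 - t) t₀ with h | h
  · exact (mul_le_of_le_one_left h1t.le (followerWin_le_one _ _)).trans h
  rw [← le_div_iff₀ h1t, stepStrategy, followerWin_pureStrategy]
  calc typeLaw.real {x | stepBid t₀ x ≤ t} ≤ typeLaw.real (Iic (t₀ / (1 - t))) := by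
        refine ENNReal.toReal_mono (measure_ne_top _ _) (measure_mono_ae ?_)
        refine ae_typeLaw_of_forall fun x hx hxt => ?_
        change stepBid t₀ x ≤ t at hxt
        change x ≤ t₀ / (1 - t)
        rw [stepBid_eq hx.1, div_le_iff₀ hx.1] at hxt
        rw [le_div_iff₀ h1t]
        linarith [le_max_left (x - t₀) 0]
    _ = t₀ / (1 - t) := typeLaw_real_Iic ⟨by positivity, (div_le_one h1t).2 h⟩

theorem zero_mem_bestResponses_stepStrategy (h0 : 0 < t₀) (h1 : t₀ < 1) {y : ℝ}
    (hy : y ∈ Icc (0 : ℝ) 1) : 0 ∈ bestResponses (stepStrategy t₀) y := by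
  refine ⟨le_rfl, fun t ht => ?_⟩
  rw [followerPayoff, followerPayoff, followerWin_stepStrategy_zero h0 h1, sub_zero]
  have hF := followerWin_nonneg (stepStrategy t₀) t
  rcases le_or_gt y t with h | h
  · exact (mul_nonpos_of_nonpos_of_nonneg (sub_nonpos.2 h) hF).trans (mul_nonneg hy.1 h0.le)
  · have h2 := mul_le_mul_of_nonneg_left
      (followerWin_stepStrategy_mul_le h0 (h.trans_le hy.2)) hy.1
    have h3 := mul_nonneg (mul_nonneg ht (sub_nonneg.2 hy.2)) hF
    linarith

theorem response_stepStrategy (h0 : 0 < t₀) (h1 : t₀ < 1) {y : ℝ} (hy : y ∈ Icc (0 : ℝ) 1) :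
    response (stepStrategy t₀) y = 0 :=
  le_antisymm ((isLeast_response hy.1).2 (zero_mem_bestResponses_stepStrategy h0 h1 hy))
    (response_nonneg hy.1)

theorem equalUtility_stepStrategy (h0 : 0 < t₀) (h1 : t₀ < 1) {y : ℝ} (hy : y ∈ Icc (0 : ℝ) 1)
    (x : ℝ) : equalUtility (stepStrategy t₀) y x = y * (1 - t₀ / x) := by
  rw [equalUtility, followerUtility_eq_of_mem (zero_mem_bestResponses_stepStrategy h0 h1 hy),
    followerPayoff, followerWin_stepStrategy_zero h0 h1]
  ring

theorem smoothed_stepStrategy (h0 : 0 < t₀) (h1 : t₀ < 1) {x : ℝ} (hx : 0 < x) :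
    smoothed (stepStrategy t₀) x = stepBid t₀ x := by
  refine IsGreatest.csSup_eq ⟨⟨stepG t₀ x, stepG_mem t₀ x, ?_⟩, ?_⟩
  · simp only [equalUtility_stepStrategy h0 h1 (stepG_mem t₀ x)]
    unfold stepG stepBid
    split_ifs <;> simp
  · rintro _ ⟨y, hy, rfl⟩
    simp only [equalUtility_stepStrategy h0 h1 hy]
    unfold stepBid
    split_ifs with h
    · exact mul_nonpos_of_nonneg_of_nonpos hy.1 (sub_nonpos.2 ((one_le_div hx).2 h))
    · exact mul_le_of_le_one_left (sub_nonneg.2 ((div_le_one hx).2 (not_le.1 h).le)) hy.2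

/-- The curve value y * (1 - t₀/x) is linear in y, so its maximum sits at an endpoint chosen by the
sign of x - t₀. At x = t₀ every type attains it, and the minimum selects 0. -/
theorem isLeast_equalBidTypes_stepStrategy (h0 : 0 < t₀) (h1 : t₀ < 1) {x : ℝ} (hx : 0 < x) :
    IsLeast (equalBidTypes (stepStrategy t₀) x) (stepG t₀ x) := by
  constructor
  · refine ⟨stepG_mem t₀ x, ?_⟩
    rw [equalUtility_stepStrategy h0 h1 (stepG_mem t₀ x), smoothed_stepStrategy h0 h1 hx]
    unfold stepG stepBid
    split_ifs <;> simp
  · rintro y ⟨hy, hyx⟩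
    rw [equalUtility_stepStrategy h0 h1 hy, smoothed_stepStrategy h0 h1 hx] at hyx
    unfold stepG
    unfold stepBid at hyx
    split_ifs at hyx ⊢ with h
    · exact hy.1
    · have hpos : 0 < 1 - t₀ / x := sub_pos.2 ((div_lt_one hx).2 (not_le.1 h))
      exact ((mul_eq_right₀ hpos.ne').1 hyx).ge

theorem leaderWin_stepStrategy_of_pos (h0 : 0 < t₀) (h1 : t₀ < 1) {b : ℝ} (hb : 0 < b) :
    leaderWin (stepStrategy t₀) b = 1 := by
  rw [leaderWin, ← probReal_univ (μ := typeLaw)]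
  refine measureReal_congr ?_
  filter_upwards [ae_typeLaw_of_forall fun y hy => hy] with y hy
  refine propext (show response (stepStrategy t₀) y < b ↔ True from ?_)
  simp [response_stepStrategy h0 h1 ⟨hy.1.le, hy.2.le⟩, hb]

/-- The follower always bids 0. Types above t₀ bid a positive amount and win surely; the others tie
at 0 and lose. -/
theorem leaderPayoff_stepStrategy (h0 : 0 < t₀) (h1 : t₀ < 1) {x : ℝ} (hx : 0 < x) :
    leaderPayoff (stepStrategy t₀) (x, stepBid t₀ x) = (x - bidOf (stepG t₀) x) * stepG t₀ x := by
  rw [leaderPayoff, bidOf_stepG h0.le hx]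
  congr 1
  by_cases h : x ≤ t₀
  · rw [stepBid, stepG, if_pos h, if_pos h, leaderWin_of_nonpos le_rfl]
  · rw [stepBid, stepG, if_neg h, if_neg h]
    exact leaderWin_stepStrategy_of_pos h0 h1 (sub_pos.2 ((div_lt_one hx).2 (not_le.1 h)))

theorem ae_leaderPayoff_stepStrategy (h0 : 0 < t₀) (h1 : t₀ < 1) :
    (fun x => leaderPayoff (stepStrategy t₀) (x, stepBid t₀ x)) =ᵐ[typeLaw]
      fun x => (x - bidOf (stepG t₀) x) * stepG t₀ x :=
  ae_typeLaw_of_forall fun _ hx => leaderPayoff_stepStrategy h0 h1 hx.1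

theorem integrable_leaderPayoff_stepStrategy (h0 : 0 < t₀) (h1 : t₀ < 1) :
    Integrable (leaderPayoff (stepStrategy t₀)) (typeLaw ⊗ₘ stepStrategy t₀) := by
  have hae : AEMeasurable (fun x => (x, stepBid t₀ x)) typeLaw :=
    (measurable_id.prodMk (measurable_stepBid t₀)).aemeasurable
  have hm := measurable_leaderPayoff (stepStrategy t₀)
  rw [show typeLaw ⊗ₘ stepStrategy t₀ = _ from compProd_pureStrategy (measurable_stepBid t₀),
    integrable_map_measure hm.aestronglyMeasurable hae]
  exact (integrable_typeLaw_of_bound (measurable_sub_bidOf_mul (monotone_stepG t₀)) 1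
    fun x hx => abs_sub_bidOf_mul_le (monotone_stepG t₀) (stepG_mem t₀) hx).congr
    (ae_leaderPayoff_stepStrategy h0 h1).symm

theorem leaderUtility_stepStrategy (h0 : 0 < t₀) (h1 : t₀ < 1) :
    leaderUtility (stepStrategy t₀) = objective (stepG t₀) := by
  have hae : AEMeasurable (fun x => (x, stepBid t₀ x)) typeLaw :=
    (measurable_id.prodMk (measurable_stepBid t₀)).aemeasurable
  have hm := measurable_leaderPayoff (stepStrategy t₀)
  rw [leaderUtility,
    show typeLaw ⊗ₘ stepStrategy t₀ = _ from compProd_pureStrategy (measurable_stepBid t₀),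
    integral_map hae hm.aestronglyMeasurable,
    integral_congr_ae (ae_leaderPayoff_stepStrategy h0 h1),
    objective_eq fun x _ => stepG_mem t₀ x, integral_typeLaw]

end Step

end FirstPriceCommitment

theorem mainTheorem10 :
    -- The follower's lowest best response exists, against every strategy of the leader.
    (∀ (s : ProbabilityTheory.Kernel ℝ ℝ) [ProbabilityTheory.IsMarkovKernel s],
      ∀ y ∈ Set.Icc (0 : ℝ) 1,
        IsLeast (FirstPriceCommitment.bestResponses s y) (FirstPriceCommitment.response s y)) ∧
    ∃ t₀ : ℝ,
      -- The threshold.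
      (0 < t₀ ∧ t₀ < 1 ∧ t₀ = -Real.log t₀ ∧ (∀ t : ℝ, 0 < t → t = -Real.log t → t = t₀) ∧
        t₀ = (∫ x in t₀..1, 1 / x) ∧ |t₀ - 0.567| < 0.0005) ∧
      -- The optimal equal-bid function.
      (FirstPriceCommitment.IsEqualBid (FirstPriceCommitment.stepG t₀) ∧
        ∀ g : ℝ → ℝ, FirstPriceCommitment.IsEqualBid g →
          FirstPriceCommitment.objective g ≤
              FirstPriceCommitment.objective (FirstPriceCommitment.stepG t₀) ∧
            (FirstPriceCommitment.objective g =
                FirstPriceCommitment.objective (FirstPriceCommitment.stepG t₀) →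
              ∀ x ∈ Set.Ioc (0 : ℝ) 1, g x = FirstPriceCommitment.stepG t₀ x)) ∧
      -- It corresponds to the commitment, in both directions.
      (∀ x ∈ Set.Ioc (0 : ℝ) 1,
        FirstPriceCommitment.bidOf (FirstPriceCommitment.stepG t₀) x =
            FirstPriceCommitment.stepBid t₀ x ∧
          FirstPriceCommitment.smoothed (FirstPriceCommitment.stepStrategy t₀) x =
            FirstPriceCommitment.stepBid t₀ x ∧
          IsLeast (FirstPriceCommitment.equalBidTypes (FirstPriceCommitment.stepStrategy t₀) x)
            (FirstPriceCommitment.stepG t₀ x)) ∧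
      -- The commitment is optimal among all strategies of the leader.
      (∀ (s : ProbabilityTheory.Kernel ℝ ℝ) [ProbabilityTheory.IsMarkovKernel s],
        FirstPriceCommitment.leaderUtility s ≤
          FirstPriceCommitment.leaderUtility (FirstPriceCommitment.stepStrategy t₀)) ∧
      -- It is the only optimal one among the weakly increasing nonnegative pure strategies.
      (∀ (f : ℝ → ℝ) (hf : Measurable f), MonotoneOn f (Set.Icc 0 1) →
        (∀ x ∈ Set.Icc (0 : ℝ) 1, 0 ≤ f x) →
        FirstPriceCommitment.leaderUtility (FirstPriceCommitment.pureStrategy f hf) =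
          FirstPriceCommitment.leaderUtility (FirstPriceCommitment.stepStrategy t₀) →
        ∀ x ∈ Set.Ico (0 : ℝ) 1, f x = FirstPriceCommitment.stepBid t₀ x) ∧
      -- The optimal utility.
      (MeasureTheory.Integrable
          (FirstPriceCommitment.leaderPayoff (FirstPriceCommitment.stepStrategy t₀))
          (MeasureTheory.Measure.compProd FirstPriceCommitment.typeLaw
            (FirstPriceCommitment.stepStrategy t₀)) ∧
        FirstPriceCommitment.leaderUtility (FirstPriceCommitment.stepStrategy t₀) =
          FirstPriceCommitment.objective (FirstPriceCommitment.stepG t₀) ∧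
        FirstPriceCommitment.leaderUtility (FirstPriceCommitment.stepStrategy t₀) =
          t₀ + t₀ ^ 2 / 2 - 1 / 2 ∧
        |FirstPriceCommitment.leaderUtility (FirstPriceCommitment.stepStrategy t₀) - 0.228|
          < 0.0005) := by
  refine ⟨fun s _ y hy => FirstPriceCommitment.isLeast_response hy.1, ?_⟩
  obtain ⟨t₀, hlo, hhi, ht, huniq⟩ := FirstPriceCommitment.exists_threshold
  have h0 : 0 < t₀ := lt_trans (by norm_num) hlo
  have h1 : t₀ < 1 := hhi.trans (by norm_num)
  have hobj := FirstPriceCommitment.objective_stepG h0 h1 ht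
  have hU := FirstPriceCommitment.leaderUtility_stepStrategy h0 h1
  have hpos : 0 < FirstPriceCommitment.objective (FirstPriceCommitment.stepG t₀) := by
    rw [hobj]
    nlinarith
  refine ⟨t₀, ⟨h0, h1, ht, huniq, ?_, ?_⟩, ⟨FirstPriceCommitment.isEqualBid_stepG, fun g hg =>
    ⟨FirstPriceCommitment.objective_le_stepG h0 h1 ht hg, fun heq x hx =>
      FirstPriceCommitment.eqOn_stepG_of_objective_eq h0 h1 ht hg heq hx⟩⟩,
    fun x hx => ⟨FirstPriceCommitment.bidOf_stepG h0.le hx.1,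
      FirstPriceCommitment.smoothed_stepStrategy h0 h1 hx.1,
      FirstPriceCommitment.isLeast_equalBidTypes_stepStrategy h0 h1 hx.1⟩,
    fun s _ => ?_, fun f hf hmono hnn hopt x hx => ?_,
    FirstPriceCommitment.integrable_leaderPayoff_stepStrategy h0 h1, hU, hU.trans hobj, ?_⟩
  · rw [integral_one_div_of_pos h0 one_pos, one_div, Real.log_inv]
    exact ht
  · rw [abs_lt]
    constructor <;> linarith
  · rw [hU]
    exact FirstPriceCommitment.leaderUtility_le h0 h1 ht hpos.le
  · exact FirstPriceCommitment.eq_stepBid_of_optimal h0 h1 ht hpos hf hmono hnn (hopt.trans hU) hx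
  · rw [hU, hobj, abs_lt]
    constructor <;> nlinarith
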